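/- **Conventions.** For $0<\alpha<1$, $S_\alpha$ denotes a positive $\alpha$-stable random variable: $S_\alpha>0$ a.s. and $\mathbb E e^{-tS_\alpha}=e^{-t^\alpha}$ for $t>0$. For a positive random variable $X$ put $\rho_+=\sup\{s\in\mathbb R:\mathbb E X^s<\infty\}$ and $\rho_-=\inf\{s\in\mathbb R:\mathbb E X^s<\infty\}$. $X$ has *moments of Gamma type* (on a strip) if there $\mathbb E X^s=C D^s\prod_{j=1}^J\Gamma(a_js+b_j)\big/\prod_{k=1}^K\Gamma(a_k's+b_k')$ for some real constants $C$, $D>0$, $a_j\neq0$, $b_j$, $a_k'\ne0$, $b_k'$; then one sets $\gamma=\sum_j|a_j|-\sum_k|a_k'|$, $\gamma'=\sum_j a_j-\sum_k a_k'$, $\delta=\sum_j b_j-\sum_k b_k'-\frac{J-K}2$, $\kappa=\sum_j a_j\log|a_j|-\sum_k a_k'\log|a_k'|+\log D$, $C_1=C(2\pi)^{(J-K)/2}\prod_j|a_j|^{b_j-1/2}\big/\prod_k|a'_k|^{b'_k-1/2}$. All moments below are absolutely convergent expectations for complex $s$; the expressions containing $\sin$ in a denominator, or $\Gamma(s)$,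 are asserted for $s\neq 0$ (at $s=0$ the moment is $1$). **(i) Lamperti variables.** Let $0<\alpha<1$ and $L_\alpha=S_\alpha/S_\alpha'$, where $S_\alpha,S_\alpha'$ are independent positive $\alpha$-stable variables. For $-\alpha<\operatorname{Re}s<\alpha$, $$\mathbb E L_\alpha^s=\mathbb E S_\alpha^s\,\mathbb E S_\alpha^{-s}=\frac{\Gamma(1-s/\alpha)\Gamma(1+s/\alpha)}{\Gamma(1-s)\Gamma(1+s)}=\frac{\Gamma(s/\alpha)\Gamma(1-s/\alpha)}{\alpha\Gamma(s)\Gamma(1-s)}=\frac{\sin(\pi s)}{\alpha\sin(\pi s/\alpha)},$$ so $L_\alpha$ has moments of Gamma type, with $\rho_\pm=\pm\alpha$, $\gamma=2\alpha^{-1}-2$, $\gamma'=\delta=\kappa=0$, $C_1=1/\alpha$. Further, $L_\alpha^\alpha=M'_\alpha/M_\alpha$ a.s., where $M_\alpha=S_\alpha^{-\alpha}$, $M_\alpha'=(S'_\alpha)^{-\alpha}$ are i.i.d. with the Mittag-Leffler distribution (the positive distribution with $\mathbb E e^{tM_\alpha}=\sum_{n\ge0}t^n/\Gamma(1+\alpha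 n)$, $t\in\mathbb R$), and for $-1<\operatorname{Re}s<1$, $$\mathbb E(L_\alpha^\alpha)^s=\frac{\Gamma(1-s)\Gamma(1+s)}{\Gamma(1-\alpha s)\Gamma(1+\alpha s)}=\frac{\sin(\pi\alpha s)}{\alpha\sin(\pi s)},$$ so $L_\alpha^\alpha$ has moments of Gamma type, with $\rho_\pm=\pm1$, $\gamma=2-2\alpha$, $\gamma'=\delta=\kappa=0$, $C_1=1/\alpha$. The densities on $(0,\infty)$ of $L_\alpha^\alpha$ and $L_\alpha$ are, respectively, $$\frac{\sin(\pi\alpha)}{\pi\alpha}\,\frac1{x^2+2\cos(\pi\alpha)x+1},\qquad \frac{\sin(\pi\alpha)}{\pi}\,\frac{x^{\alpha-1}}{x^{2\alpha}+2\cos(\pi\alpha)x^\alpha+1}.$$ For $\alpha=1/2$, $\mathbb E(L_{1/2}^{1/2})^s=1/\cos(\pi s/2)$ for $-1<\operatorname{Re}s<1$, and $L_{1/2}^{1/2}$ has the law of the absolute value of a standard Cauchy variable. **(ii) Kotz–Ostrovskii variables.** Let $0<\alpha<\beta\le2$ and $Y_{\alpha,\beta}=(L_{\alpha/\beta}^{\alpha/\beta})^{1/\alpha}=L_{\alpha/\beta}^{1/\beta}$.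 For $-\alpha<\operatorname{Re}s<\alpha$, $$\mathbb E Y_{\alpha,\beta}^s=\mathbb E L_{\alpha/\beta}^{s/\beta}=\frac{\Gamma(1+s/\alpha)\Gamma(1-s/\alpha)}{\Gamma(1+s/\beta)\Gamma(1-s/\beta)}=\frac{\beta\sin(\pi s/\beta)}{\alpha\sin(\pi s/\alpha)},$$ so $Y_{\alpha,\beta}$ has moments of Gamma type, with $\rho_\pm=\pm\alpha$, $\gamma=2\alpha^{-1}-2\beta^{-1}$, $\gamma'=\delta=\kappa=0$, $C_1=\beta/\alpha$. **(iii) James's variables.** Let $0<\alpha<1$, $\theta>-\alpha$, and $X_{\alpha,\theta}=S_\alpha/S_{\alpha,\theta}$, where $S_\alpha$ and $S_{\alpha,\theta}$ are independent and the law of $S_{\alpha,\theta}$ is the law of $S_\alpha$ tilted by $x^{-\theta}$, i.e. $\mathbb P(S_{\alpha,\theta}\in dx)=x^{-\theta}\,\mathbb P(S_\alpha\in dx)/\mathbb E S_\alpha^{-\theta}$ (where $0<\mathbb E S_\alpha^{-\theta}<\infty$). Both $S_{\alpha,\theta}$ and $X_{\alpha,\theta}$ have moments of Gamma type: $$\mathbb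 E S_{\alpha,\theta}^s=\frac{\mathbb E S_\alpha^{s-\theta}}{\mathbb E S_\alpha^{-\theta}}=\frac{\Gamma(1+\theta)}{\Gamma(1+\theta/\alpha)}\,\frac{\Gamma(1-s/\alpha+\theta/\alpha)}{\Gamma(1-s+\theta)},\qquad \operatorname{Re}s<\alpha+\theta,$$ $$\mathbb E X_{\alpha,\theta}^s=\mathbb E S_\alpha^s\,\mathbb E S_{\alpha,\theta}^{-s}=\frac{\Gamma(1+\theta)}{\Gamma(1+\theta/\alpha)}\,\frac{\Gamma(1-s/\alpha)\Gamma(1+s/\alpha+\theta/\alpha)}{\Gamma(1-s)\Gamma(1+s+\theta)},\qquad-\alpha-\theta<\operatorname{Re}s<\alpha,$$ and $X_{\alpha,\theta}$ has $\rho_+=\alpha$, $\rho_-=-\alpha-\theta$, $\gamma=2(1/\alpha-1)$, $\gamma'=0$, $\delta=\theta(1/\alpha-1)$, $\kappa=0$. -/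

import Mathlib

open MeasureTheory ProbabilityTheory

namespace GammaMoments

noncomputable section

/-- `X` is (a.s.) a positive random variable with the positive `α`-stable distribution, i.e. its
Laplace transform is `E exp (-t X) = exp (-t ^ α)` for `t > 0`. -/
structure IsPositiveStable {Ω : Type*} [MeasurableSpace Ω] (α : ℝ) (X : Ω → ℝ)
    (μ : Measure Ω) : Prop where
  aemeasurable : AEMeasurable X μ
  pos : ∀ᵐ ω ∂μ, 0 < X ω
  laplace : ∀ t : ℝ, 0 < t → ∫ ω, Real.exp (-t * X ω) ∂μ = Real.exp (-t ^ α)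

/-- `M` is (a.s.) a positive random variable with the Mittag-Leffler distribution of index `α`:
its moment generating function is the Mittag-Leffler function,
`E exp (t M) = ∑ tⁿ / Γ(1 + α n)` for all real `t`. -/
structure IsMittagLeffler {Ω : Type*} [MeasurableSpace Ω] (α : ℝ) (M : Ω → ℝ)
    (μ : Measure Ω) : Prop where
  aemeasurable : AEMeasurable M μ
  pos : ∀ᵐ ω ∂μ, 0 < M ω
  integrable_exp : ∀ t : ℝ, Integrable (fun ω => Real.exp (t * M ω)) μ
  mgf : ∀ t : ℝ, HasSum (fun n : ℕ => t ^ n / Real.Gamma (1 + α * n))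
    (∫ ω, Real.exp (t * M ω) ∂μ)

/-- The complex moment `E X ^ s` of a positive random variable `X`. -/
def cmoment {Ω : Type*} [MeasurableSpace Ω] (μ : Measure Ω) (X : Ω → ℝ) (s : ℂ) : ℂ :=
  ∫ ω, (X ω : ℂ) ^ s ∂μ

/-- The complex moment `E X ^ s` exists (as an absolutely convergent integral) and equals `v`. -/
def HasMoment {Ω : Type*} [MeasurableSpace Ω] (μ : Measure Ω) (X : Ω → ℝ) (s v : ℂ) : Prop :=
  Integrable (fun ω => (X ω : ℂ) ^ s) μ ∧ cmoment μ X s = v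

/-- `ρ₊ = sup {s : E X ^ s < ∞}`, for a positive random variable `X`. -/
def rhoPlus {Ω : Type*} [MeasurableSpace Ω] (μ : Measure Ω) (X : Ω → ℝ) : EReal :=
  sSup ((fun s : ℝ => (s : EReal)) '' {s : ℝ | Integrable (fun ω => X ω ^ s) μ})

/-- `ρ₋ = inf {s : E X ^ s < ∞}`, for a positive random variable `X`. -/
def rhoMinus {Ω : Type*} [MeasurableSpace Ω] (μ : Measure Ω) (X : Ω → ℝ) : EReal :=
  sInf ((fun s : ℝ => (s : EReal)) '' {s : ℝ | Integrable (fun ω => X ω ^ s) μ})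

/-- The law `ν` on `(0, ∞)` tilted by `x ^ r`: the measure `x ^ r / (∫ y ^ r dν(y)) dν(x)`. -/
def powTilt (ν : Measure ℝ) (r : ℝ) : Measure ℝ :=
  ν.withDensity fun x => ENNReal.ofReal (x ^ r / ∫ y, y ^ r ∂ν)

/-- `X` is a positive random variable with density `f` on `(0, ∞)`. -/
def HasPosDensity {Ω : Type*} [MeasurableSpace Ω] (μ : Measure Ω) (X : Ω → ℝ)
    (f : ℝ → ℝ) : Prop :=
  HasLaw X ((volume.restrict (Set.Ioi 0)).withDensity fun x => ENNReal.ofReal (f x)) μ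

/-- The data of a function `C D ^ s ∏ⱼ Γ(aⱼ s + bⱼ) / ∏ₖ Γ(a'ₖ s + b'ₖ)` of Gamma type, with real
parameters. -/
structure GammaData where
  J : ℕ
  K : ℕ
  C : ℝ
  D : ℝ
  a : Fin J → ℝ
  b : Fin J → ℝ
  a' : Fin K → ℝ
  b' : Fin K → ℝ
  D_pos : 0 < D
  a_ne : ∀ j, a j ≠ 0
  a'_ne : ∀ k, a' k ≠ 0

namespace GammaData

/-- The function `C D ^ s ∏ⱼ Γ(aⱼ s + bⱼ) / ∏ₖ Γ(a'ₖ s + b'ₖ)`. -/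
def fn (g : GammaData) (s : ℂ) : ℂ :=
  (g.C : ℂ) * (g.D : ℂ) ^ s * (∏ j, Complex.Gamma (g.a j * s + g.b j)) /
    ∏ k, Complex.Gamma (g.a' k * s + g.b' k)

/-- `γ = ∑ |aⱼ| - ∑ |a'ₖ|`. -/
def gam (g : GammaData) : ℝ := ∑ j, |g.a j| - ∑ k, |g.a' k|

/-- `γ' = ∑ aⱼ - ∑ a'ₖ`. -/
def gam' (g : GammaData) : ℝ := ∑ j, g.a j - ∑ k, g.a' k

/-- `δ = ∑ bⱼ - ∑ b'ₖ - (J - K) / 2`. -/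
def del (g : GammaData) : ℝ := ∑ j, g.b j - ∑ k, g.b' k - ((g.J : ℝ) - g.K) / 2

/-- `κ = ∑ aⱼ log |aⱼ| - ∑ a'ₖ log |a'ₖ| + log D`. -/
def kap (g : GammaData) : ℝ :=
  ∑ j, g.a j * Real.log |g.a j| - ∑ k, g.a' k * Real.log |g.a' k| + Real.log g.D

/-- `C₁ = C (2π) ^ ((J - K) / 2) ∏ |aⱼ| ^ (bⱼ - 1/2) / ∏ |a'ₖ| ^ (b'ₖ - 1/2)`. -/
def C₁ (g : GammaData) : ℝ :=
  g.C * (2 * Real.pi) ^ (((g.J : ℝ) - g.K) / 2) * (∏ j, |g.a j| ^ (g.b j - 1 / 2)) /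
    ∏ k, |g.a' k| ^ (g.b' k - 1 / 2)

end GammaData

/-- The positive random variable `X` has moments of Gamma type on the strip `U`, given by the
function with data `g`. -/
def IsGammaType {Ω : Type*} [MeasurableSpace Ω] (μ : Measure Ω) (X : Ω → ℝ) (U : Set ℂ)
    (g : GammaData) : Prop :=
  (∀ᵐ ω ∂μ, 0 < X ω) ∧ ∀ s ∈ U, HasMoment μ X s (g.fn s)

end

end GammaMoments

open GammaMoments

/-!
For a nonnegative `φ`, Tonelli's theorem turns `∫₀^∞ t ^ (p - 1) E φ(X t) dt` into `E X ^ (-p)`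
times the Mellin transform of `φ` at `p`. For a stable `X` and `φ(t) = exp (-t)` or `1 - exp (-t)`
the expectation is `φ(t ^ α)`, whose Mellin transform is again that of `φ`, at `p / α`, divided by
`α`. Comparing the two gives the negative moments and the exact range of finite moments, and
analytic continuation gives `E X ^ s = Γ(1 - s / α) / Γ(1 - s)` on the half-plane `re s < α`. The
negative moments of order `-α n` are, up to `n!`, the coefficients of the Mittag-Leffler function.

Independence multiplies moments, and Euler's reflection formula reduces the moments of quotients to
sines. The density of `L_α ^ α` is identified through its moments: the Stieltjes-type integral
`∫₀^∞ x ^ s / (x + z) dx = Γ(1 + s) Γ(-s) z ^ s` extends from `z > 0` to the slit plane, and its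
imaginary part at `z = exp (-iπα)` is the `s`-th moment of the claimed density up to the factor
`πα`; moments on an interval determine a law on `(0, ∞)`. Tilting a law by `x ^ (-θ)` shifts its
moments by `-θ`.
-/

namespace GammaMoments

section Moments

variable {Ω : Type*} [MeasurableSpace Ω] {μ : Measure Ω} {X Y : Ω → ℝ}

lemma ofReal_cpow_eq_exp {x : ℝ} (hx : 0 < x) (s : ℂ) :
    (x : ℂ) ^ s = Complex.exp (s * (Real.log x : ℝ)) := by
  rw [Complex.cpow_def_of_ne_zero (by exact_mod_cast hx.ne'), Complex.ofReal_log hx.le, mul_comm]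

lemma cmoment_eq_complexMGF_log (hX : ∀ᵐ ω ∂μ, 0 < X ω) (s : ℂ) :
    cmoment μ X s = complexMGF (fun ω => Real.log (X ω)) μ s :=
  integral_congr_ae <| hX.mono fun _ hω => ofReal_cpow_eq_exp hω s

lemma cmoment_ofReal (hX : ∀ᵐ ω ∂μ, 0 < X ω) (s : ℝ) :
    cmoment μ X s = ((∫ ω, X ω ^ s ∂μ : ℝ) : ℂ) :=
  (integral_congr_ae <| hX.mono fun _ hω => (Complex.ofReal_cpow hω.le s).symm).trans
    integral_complex_ofReal

lemma integrable_cpow_iff (hXm : AEMeasurable X μ) (hX : ∀ᵐ ω ∂μ, 0 < X ω) (s : ℂ) :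
    Integrable (fun ω => (X ω : ℂ) ^ s) μ ↔ Integrable (fun ω => X ω ^ s.re) μ := by
  have hm : AEStronglyMeasurable (fun ω => (X ω : ℂ) ^ s) μ :=
    (Complex.measurable_ofReal.comp_aemeasurable hXm).pow_const s |>.aestronglyMeasurable
  rw [← integrable_norm_iff hm]
  exact integrable_congr <| hX.mono fun _ hω => Complex.norm_cpow_eq_rpow_re_of_pos hω s

lemma mem_integrableExpSet_log_iff (hX : ∀ᵐ ω ∂μ, 0 < X ω) (s : ℝ) :
    s ∈ integrableExpSet (fun ω => Real.log (X ω)) μ ↔ Integrable (fun ω => X ω ^ s) μ :=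
  integrable_congr <| hX.mono fun ω hω => by simp only [Real.rpow_def_of_pos hω, mul_comm s]

lemma differentiableOn_cmoment (hX : ∀ᵐ ω ∂μ, 0 < X ω) {I : Set ℝ} (hI : IsOpen I)
    (hint : ∀ s ∈ I, Integrable (fun ω => X ω ^ s) μ) :
    DifferentiableOn ℂ (cmoment μ X) (Complex.re ⁻¹' I) := by
  have hsub : Complex.re ⁻¹' I ⊆
      {z | z.re ∈ interior (integrableExpSet (fun ω => Real.log (X ω)) μ)} := fun z hz =>
    interior_maximal (fun s hs => (mem_integrableExpSet_log_iff hX s).2 (hint s hs)) hI hz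
  exact (differentiableOn_complexMGF.mono hsub).congr fun s _ => cmoment_eq_complexMGF_log hX s

lemma eqOn_of_eventually_eq_ofReal {f g : ℂ → ℂ} {U : Set ℂ} (hU : IsOpen U)
    (hU' : IsPreconnected U) (hf : DifferentiableOn ℂ f U) (hg : DifferentiableOn ℂ g U) {m : ℝ}
    (hm : (m : ℂ) ∈ U) (h : ∀ᶠ x : ℝ in nhds m, f x = g x) : Set.EqOn f g U := by
  have hreal : Filter.Tendsto (fun x : ℝ => (x : ℂ)) (nhdsWithin m {m}ᶜ)
      (nhdsWithin (m : ℂ) {(m : ℂ)}ᶜ) :=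
    tendsto_nhdsWithin_iff.2
      ⟨(Complex.continuous_ofReal.tendsto m).mono_left nhdsWithin_le_nhds,
        eventually_mem_nhdsWithin.mono fun x hx => Complex.ofReal_injective.ne hx⟩
  exact (hf.analyticOnNhd hU).eqOn_of_preconnected_of_frequently_eq (hg.analyticOnNhd hU) hU' hm
    (hreal.frequently (h.filter_mono nhdsWithin_le_nhds).frequently)

lemma eqOn_re_preimage_of_eq_ofReal {f g : ℂ → ℂ} {I : Set ℝ} (hI : IsOpen I)
    (hI' : I.OrdConnected) (hf : DifferentiableOn ℂ f (Complex.re ⁻¹' I))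
    (hg : DifferentiableOn ℂ g (Complex.re ⁻¹' I)) {c d : ℝ} (hcd : c < d)
    (hsub : Set.Ioo c d ⊆ I) (h : ∀ s : ℝ, c < s → s < d → f s = g s) :
    Set.EqOn f g (Complex.re ⁻¹' I) := by
  have hconv : Convex ℝ (Complex.re ⁻¹' I) :=
    hI'.convex.is_linear_preimage Complex.reLm.isLinear
  obtain ⟨m, hcm, hmd⟩ := exists_between hcd
  exact eqOn_of_eventually_eq_ofReal (hI.preimage Complex.continuous_re) hconv.isPreconnected hf hg
    (hsub ⟨hcm, hmd⟩) (Filter.mem_of_superset (Ioo_mem_nhds hcm hmd) fun x hx => h x hx.1 hx.2)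

lemma hasMoment_of_integral_rpow_eq (hXm : AEMeasurable X μ) (hX : ∀ᵐ ω ∂μ, 0 < X ω) {I : Set ℝ}
    (hI : IsOpen I) (hI' : I.OrdConnected) (hint : ∀ s ∈ I, Integrable (fun ω => X ω ^ s) μ)
    {f : ℂ → ℂ} (hf : DifferentiableOn ℂ f (Complex.re ⁻¹' I))
    {c d : ℝ} (hcd : c < d) (hsub : Set.Ioo c d ⊆ I)
    (h : ∀ s : ℝ, c < s → s < d → ((∫ ω, X ω ^ s ∂μ : ℝ) : ℂ) = f s) {s : ℂ} (hs : s.re ∈ I) :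
    HasMoment μ X s (f s) :=
  ⟨(integrable_cpow_iff hXm hX s).2 (hint _ hs),
    eqOn_re_preimage_of_eq_ofReal hI hI' (differentiableOn_cmoment hX hI hint) hf hcd hsub
      (fun r hcr hrd => (cmoment_ofReal hX r).trans (h r hcr hrd)) hs⟩

lemma map_eq_map_log_map_exp (hXm : AEMeasurable X μ) (hX : ∀ᵐ ω ∂μ, 0 < X ω) :
    μ.map X = (μ.map (fun ω => Real.log (X ω))).map Real.exp := by
  rw [AEMeasurable.map_map_of_aemeasurable Real.measurable_exp.aemeasurable hXm.log]
  exact Measure.map_congr <| hX.mono fun ω hω => (Real.exp_log hω).symm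

lemma map_eq_map_of_integral_rpow_eq {Ω' : Type*} [MeasurableSpace Ω'] {ν : Measure Ω'}
    {Y : Ω' → ℝ} [IsFiniteMeasure μ] [IsFiniteMeasure ν]
    (hXm : AEMeasurable X μ) (hX : ∀ᵐ ω ∂μ, 0 < X ω)
    (hYm : AEMeasurable Y ν) (hY : ∀ᵐ ω ∂ν, 0 < Y ω) {I : Set ℝ} (hI : IsOpen I)
    (hI' : I.OrdConnected) (hI0 : 0 ∈ I) (hXi : ∀ s ∈ I, Integrable (fun ω => X ω ^ s) μ)
    (hYi : ∀ s ∈ I, Integrable (fun ω => Y ω ^ s) ν) {c d : ℝ} (hcd : c < d)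
    (hsub : Set.Ioo c d ⊆ I) (h : ∀ s, c < s → s < d → ∫ ω, X ω ^ s ∂μ = ∫ ω, Y ω ^ s ∂ν) :
    μ.map X = ν.map Y := by
  have hcmoment := eqOn_re_preimage_of_eq_ofReal hI hI' (differentiableOn_cmoment hX hI hXi)
    (differentiableOn_cmoment hY hI hYi) hcd hsub fun s hcs hsd => by
      rw [cmoment_ofReal hX, cmoment_ofReal hY, h s hcs hsd]
  have hlog : μ.map (fun ω => Real.log (X ω)) = ν.map (fun ω => Real.log (Y ω)) := by
    refine Measure.ext_of_charFun (funext fun t => ?_)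
    rw [← complexMGF_mul_I hXm.log, ← complexMGF_mul_I hYm.log,
      ← cmoment_eq_complexMGF_log hX, ← cmoment_eq_complexMGF_log hY]
    exact hcmoment (by simpa using hI0)
  rw [map_eq_map_log_map_exp hXm hX, map_eq_map_log_map_exp hYm hY, hlog]

lemma ae_pos_div (hX : ∀ᵐ ω ∂μ, 0 < X ω) (hY : ∀ᵐ ω ∂μ, 0 < Y ω) :
    ∀ᵐ ω ∂μ, 0 < X ω / Y ω := by
  filter_upwards [hX, hY] with ω hXω hYω using div_pos hXω hYω

lemma ae_pos_rpow (hX : ∀ᵐ ω ∂μ, 0 < X ω) (p : ℝ) : ∀ᵐ ω ∂μ, 0 < X ω ^ p :=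
  hX.mono fun _ hω => Real.rpow_pos_of_pos hω p

lemma ae_div_cpow (hX : ∀ᵐ ω ∂μ, 0 < X ω) (hY : ∀ᵐ ω ∂μ, 0 < Y ω) (s : ℂ) :
    ∀ᵐ ω ∂μ, ((X ω / Y ω : ℝ) : ℂ) ^ s = (X ω : ℂ) ^ s * (Y ω : ℂ) ^ (-s) := by
  filter_upwards [hX, hY] with ω hXω hYω
  rw [ofReal_cpow_eq_exp (div_pos hXω hYω), ofReal_cpow_eq_exp hXω, ofReal_cpow_eq_exp hYω,
    Real.log_div hXω.ne' hYω.ne', ← Complex.exp_add]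
  push_cast
  ring_nf

lemma integrable_div_cpow_iff [NeZero μ] (hXm : AEMeasurable X μ) (hYm : AEMeasurable Y μ)
    (hX : ∀ᵐ ω ∂μ, 0 < X ω) (hY : ∀ᵐ ω ∂μ, 0 < Y ω) (hXY : IndepFun X Y μ) (s : ℂ) :
    Integrable (fun ω => ((X ω / Y ω : ℝ) : ℂ) ^ s) μ ↔
      Integrable (fun ω => (X ω : ℂ) ^ s) μ ∧ Integrable (fun ω => (Y ω : ℂ) ^ (-s)) μ := by
  have hm {Z : Ω → ℝ} (hZ : AEMeasurable Z μ) (z : ℂ) :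
      AEStronglyMeasurable (fun ω => (Z ω : ℂ) ^ z) μ :=
    ((Complex.measurable_ofReal.comp_aemeasurable hZ).pow_const z).aestronglyMeasurable
  have hne {Z : Ω → ℝ} (hZ : ∀ᵐ ω ∂μ, 0 < Z ω) (z : ℂ) : ¬ (fun ω => (Z ω : ℂ) ^ z) =ᵐ[μ] 0 := by
    intro h
    obtain ⟨ω, hω, h0⟩ := (hZ.and h).exists
    simp [ofReal_cpow_eq_exp hω] at h0
  have hind : IndepFun (fun ω => (X ω : ℂ) ^ s) (fun ω => (Y ω : ℂ) ^ (-s)) μ :=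
    hXY.comp (φ := fun x : ℝ => (x : ℂ) ^ s) (ψ := fun x : ℝ => (x : ℂ) ^ (-s))
      (by fun_prop) (by fun_prop)
  rw [integrable_congr (ae_div_cpow hX hY s)]
  exact ⟨fun h =>
    ⟨hind.integrable_left_of_integrable_op (· * ·) 1 one_ne_zero (by simp) h (hm hXm s)
      (hm hYm (-s)) (hne hY (-s)),
    hind.integrable_right_of_integrable_op (· * ·) 1 one_ne_zero (by simp) h (hm hXm s)
      (hm hYm (-s)) (hne hX s)⟩, fun h => hind.integrable_mul h.1 h.2⟩

lemma integrable_div_rpow_iff [NeZero μ] (hXm : AEMeasurable X μ) (hYm : AEMeasurable Y μ)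
    (hX : ∀ᵐ ω ∂μ, 0 < X ω) (hY : ∀ᵐ ω ∂μ, 0 < Y ω) (hXY : IndepFun X Y μ) (s : ℝ) :
    Integrable (fun ω => (X ω / Y ω) ^ s) μ ↔
      Integrable (fun ω => X ω ^ s) μ ∧ Integrable (fun ω => Y ω ^ (-s)) μ := by
  have h := integrable_div_cpow_iff hXm hYm hX hY hXY s
  rwa [integrable_cpow_iff (X := fun ω => X ω / Y ω) (hXm.div hYm) (ae_pos_div hX hY),
    integrable_cpow_iff hXm hX, integrable_cpow_iff hYm hY] at h

lemma cmoment_div (hXm : AEMeasurable X μ) (hYm : AEMeasurable Y μ)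
    (hX : ∀ᵐ ω ∂μ, 0 < X ω) (hY : ∀ᵐ ω ∂μ, 0 < Y ω) (hXY : IndepFun X Y μ) (s : ℂ) :
    cmoment μ (fun ω => X ω / Y ω) s = cmoment μ X s * cmoment μ Y (-s) := by
  have hind : IndepFun (fun ω => (X ω : ℂ) ^ s) (fun ω => (Y ω : ℂ) ^ (-s)) μ :=
    hXY.comp (φ := fun x : ℝ => (x : ℂ) ^ s) (ψ := fun x : ℝ => (x : ℂ) ^ (-s))
      (by fun_prop) (by fun_prop)
  rw [cmoment, integral_congr_ae (ae_div_cpow hX hY s)]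
  exact hind.integral_fun_mul_eq_mul_integral
    ((Complex.measurable_ofReal.comp_aemeasurable hXm).pow_const s).aestronglyMeasurable
    ((Complex.measurable_ofReal.comp_aemeasurable hYm).pow_const (-s)).aestronglyMeasurable

lemma ofReal_rpow_cpow {x : ℝ} (hx : 0 < x) (p : ℝ) (s : ℂ) :
    ((x ^ p : ℝ) : ℂ) ^ s = (x : ℂ) ^ (p * s) := by
  rw [ofReal_cpow_eq_exp (Real.rpow_pos_of_pos hx p), ofReal_cpow_eq_exp hx, Real.log_rpow hx]
  push_cast
  ring_nf

lemma cmoment_rpow (hX : ∀ᵐ ω ∂μ, 0 < X ω) (p : ℝ) (s : ℂ) :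
    cmoment μ (fun ω => X ω ^ p) s = cmoment μ X (p * s) :=
  integral_congr_ae <| hX.mono fun _ hω => ofReal_rpow_cpow hω p s

lemma HasMoment.rpow {p : ℝ} {s v : ℂ} (hX : ∀ᵐ ω ∂μ, 0 < X ω) (h : HasMoment μ X (p * s) v) :
    HasMoment μ (fun ω => X ω ^ p) s v :=
  ⟨(integrable_congr <| hX.mono fun _ hω => ofReal_rpow_cpow hω p s).2 h.1,
    (cmoment_rpow hX p s).trans h.2⟩

lemma integrable_rpow_rpow_iff (hX : ∀ᵐ ω ∂μ, 0 < X ω) (p s : ℝ) :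
    Integrable (fun ω => (X ω ^ p) ^ s) μ ↔ Integrable (fun ω => X ω ^ (p * s)) μ :=
  integrable_congr <| hX.mono fun _ hω => (Real.rpow_mul hω.le p s).symm

lemma rhoPlus_eq_of_integrable_iff {a b : ℝ} (hab : a < b)
    (h : ∀ s : ℝ, Integrable (fun ω => X ω ^ s) μ ↔ s ∈ Set.Ioo a b) :
    rhoPlus μ X = (b : EReal) := by
  rw [rhoPlus, show {s : ℝ | Integrable (fun ω => X ω ^ s) μ} = Set.Ioo a b from Set.ext h,
    EReal.image_coe_Ioo, csSup_Ioo (EReal.coe_lt_coe_iff.2 hab)]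

lemma rhoMinus_eq_of_integrable_iff {a b : ℝ} (hab : a < b)
    (h : ∀ s : ℝ, Integrable (fun ω => X ω ^ s) μ ↔ s ∈ Set.Ioo a b) :
    rhoMinus μ X = (a : EReal) := by
  rw [rhoMinus, show {s : ℝ | Integrable (fun ω => X ω ^ s) μ} = Set.Ioo a b from Set.ext h,
    EReal.image_coe_Ioo, csInf_Ioo (EReal.coe_lt_coe_iff.2 hab)]

end Moments

section LMellin

open scoped ENNReal

/-- The Mellin transform `∫₀^∞ t ^ (p - 1) φ(t) dt` of a `[0, ∞]`-valued function, as a Lebesgue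
integral; it may be infinite. -/
noncomputable def lmellin (φ : ℝ → ℝ≥0∞) (p : ℝ) : ℝ≥0∞ :=
  ∫⁻ t in Set.Ioi (0 : ℝ), ENNReal.ofReal (t ^ (p - 1)) * φ t

lemma lmellin_congr {φ ψ : ℝ → ℝ≥0∞} (h : ∀ t, 0 < t → φ t = ψ t) (p : ℝ) :
    lmellin φ p = lmellin ψ p :=
  setLIntegral_congr_fun measurableSet_Ioi fun t ht => by simp only [h t ht]

lemma lintegral_comp_rpow_Ioi (g : ℝ → ℝ≥0∞) {q : ℝ} (hq : 0 < q) :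
    ∫⁻ x in Set.Ioi (0 : ℝ), ENNReal.ofReal (q * x ^ (q - 1)) * g (x ^ q) =
      ∫⁻ y in Set.Ioi (0 : ℝ), g y := by
  have himage : (fun x : ℝ => x ^ q) '' Set.Ioi 0 = Set.Ioi 0 := by
    ext y
    refine ⟨?_, fun hy => ⟨y ^ q⁻¹, Real.rpow_pos_of_pos hy _, Real.rpow_inv_rpow hy.le hq.ne'⟩⟩
    rintro ⟨x, hx, rfl⟩
    exact Real.rpow_pos_of_pos hx q
  rw [← lintegral_image_eq_lintegral_deriv_mul_of_monotoneOn measurableSet_Ioi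
    (fun x hx => (Real.hasDerivAt_rpow_const (Or.inl (ne_of_gt hx))).hasDerivWithinAt)
    (Real.monotoneOn_rpow_Ici_of_exponent_nonneg hq.le |>.mono Set.Ioi_subset_Ici_self), himage]

lemma lmellin_comp_rpow (φ : ℝ → ℝ≥0∞) {q : ℝ} (hq : 0 < q) (p : ℝ) :
    ENNReal.ofReal q * lmellin (fun t => φ (t ^ q)) p = lmellin φ (p / q) := by
  rw [lmellin, ← lintegral_const_mul' _ _ ENNReal.ofReal_ne_top, lmellin,
    ← lintegral_comp_rpow_Ioi (fun y => ENNReal.ofReal (y ^ (p / q - 1)) * φ y) hq]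
  refine setLIntegral_congr_fun measurableSet_Ioi fun t (ht : 0 < t) => ?_
  have hexp : t ^ (p - 1) = t ^ (q - 1) * (t ^ q) ^ (p / q - 1) := by
    rw [← Real.rpow_mul ht.le, ← Real.rpow_add ht]
    congr 1
    field_simp
    ring
  rw [← mul_assoc, ← mul_assoc, ← ENNReal.ofReal_mul hq.le, ← ENNReal.ofReal_mul (by positivity),
    hexp, mul_assoc]

lemma lmellin_comp_mul_left (φ : ℝ → ℝ≥0∞) {c : ℝ} (hc : 0 < c) (p : ℝ) :
    lmellin (fun t => φ (c * t)) p = ENNReal.ofReal (c ^ (-p)) * lmellin φ p := by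
  have himage : (fun x : ℝ => c * x) '' Set.Ioi 0 = Set.Ioi 0 := by
    rw [Set.image_mul_left_Ioi hc, mul_zero]
  rw [lmellin, lmellin, ← lintegral_const_mul' _ _ ENNReal.ofReal_ne_top]
  nth_rw 2 [← himage]
  rw [lintegral_image_eq_lintegral_deriv_mul_of_monotoneOn measurableSet_Ioi
    (fun x _ => (hasDerivAt_const_mul c).hasDerivWithinAt)
    (monotone_mul_left_of_nonneg hc.le |>.monotoneOn _)]
  refine setLIntegral_congr_fun measurableSet_Ioi fun t (ht : 0 < t) => ?_
  have hexp : t ^ (p - 1) = c * (c ^ (-p) * (c * t) ^ (p - 1)) := by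
    rw [Real.mul_rpow hc.le ht.le, Real.rpow_sub_one hc.ne', Real.rpow_neg hc.le]
    field_simp
  simp only [hexp, ENNReal.ofReal_mul hc.le, ENNReal.ofReal_mul (Real.rpow_nonneg hc.le (-p)),
    mul_assoc]

lemma lintegral_rpow_mul_lmellin {Ω : Type*} [MeasurableSpace Ω] {μ : Measure Ω} [SFinite μ]
    {X : Ω → ℝ} (hXm : AEMeasurable X μ) (hX : ∀ᵐ ω ∂μ, 0 < X ω) {φ : ℝ → ℝ≥0∞}
    (hφ : Measurable φ) (p : ℝ) :
    (∫⁻ ω, ENNReal.ofReal (X ω ^ (-p)) ∂μ) * lmellin φ p =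
      lmellin (fun t => ∫⁻ ω, φ (X ω * t) ∂μ) p := by
  calc (∫⁻ ω, ENNReal.ofReal (X ω ^ (-p)) ∂μ) * lmellin φ p
      = ∫⁻ ω, ENNReal.ofReal (X ω ^ (-p)) * lmellin φ p ∂μ :=
        (lintegral_mul_const'' _ (hXm.pow_const _).ennreal_ofReal).symm
    _ = ∫⁻ ω, lmellin (fun t => φ (X ω * t)) p ∂μ :=
        lintegral_congr_ae <| hX.mono fun ω hω => (lmellin_comp_mul_left φ hω p).symm
    _ = ∫⁻ t in Set.Ioi (0 : ℝ), ∫⁻ ω, ENNReal.ofReal (t ^ (p - 1)) * φ (X ω * t) ∂μ := by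
        refine lintegral_lintegral_swap (AEMeasurable.mul (by fun_prop) (hφ.comp_aemeasurable ?_))
        exact hXm.comp_fst.mul (by fun_prop)
    _ = lmellin (fun t => ∫⁻ ω, φ (X ω * t) ∂μ) p :=
        lintegral_congr fun t => lintegral_const_mul' _ _ ENNReal.ofReal_ne_top

lemma lmellin_exp_neg {p : ℝ} (hp : 0 < p) :
    lmellin (fun t => ENNReal.ofReal (Real.exp (-t))) p = ENNReal.ofReal (Real.Gamma p) := by
  rw [Real.Gamma_eq_integral hp,
    ofReal_integral_eq_lintegral_ofReal (Real.GammaIntegral_convergent hp)]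
  · refine setLIntegral_congr_fun measurableSet_Ioi fun t _ => ?_
    rw [ENNReal.ofReal_mul (Real.exp_pos _).le, mul_comm]
  · filter_upwards [self_mem_ae_restrict measurableSet_Ioi] with t (ht : 0 < t) using by positivity

lemma lmellin_one_sub_exp_neg_ne_zero (p : ℝ) :
    lmellin (fun t => ENNReal.ofReal (1 - Real.exp (-t))) p ≠ 0 := by
  have hpos : ∀ t, 0 < t →
      ENNReal.ofReal (t ^ (p - 1)) * ENNReal.ofReal (1 - Real.exp (-t)) ≠ 0 := fun t ht =>
    mul_ne_zero (ENNReal.ofReal_pos.2 (Real.rpow_pos_of_pos ht _)).ne'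
      (ENNReal.ofReal_pos.2 (sub_pos.2 (Real.exp_lt_one_iff.2 (neg_neg_of_pos ht)))).ne'
  refine ((setLIntegral_pos_iff (by fun_prop)).2 ?_).ne'
  have hvol : 0 < volume (Set.Ioi (0 : ℝ)) := Real.volume_Ioi ▸ ENNReal.zero_lt_top
  exact hvol.trans_le (measure_mono fun t ht => ⟨hpos t ht, ht⟩)

lemma lmellin_one_sub_exp_neg_lt_top {p : ℝ} (hp : -1 < p) (hp0 : p < 0) :
    lmellin (fun t => ENNReal.ofReal (1 - Real.exp (-t))) p < ⊤ := by
  rw [lmellin, ← Set.Ioo_union_Ici_eq_Ioi (zero_lt_one' ℝ)]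
  refine (lintegral_union_le _ _ _).trans_lt (ENNReal.add_lt_top.2 ⟨?_, ?_⟩)
  · refine (setLIntegral_mono' measurableSet_Ioo fun t ht => ?_).trans_lt
      ((intervalIntegral.integrableOn_Ioo_rpow_iff one_pos).2 hp).lintegral_lt_top
    rw [← ENNReal.ofReal_mul (Real.rpow_nonneg ht.1.le _)]
    refine ENNReal.ofReal_le_ofReal ?_
    calc t ^ (p - 1) * (1 - Real.exp (-t)) ≤ t ^ (p - 1) * t := by
          gcongr
          · exact Real.rpow_nonneg ht.1.le _
          · linarith [Real.add_one_le_exp (-t)]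
      _ = t ^ p := by rw [← Real.rpow_add_one ht.1.ne', sub_add_cancel]
  · rw [setLIntegral_congr Ioi_ae_eq_Ici.symm]
    refine (setLIntegral_mono' measurableSet_Ioi fun t _ => ?_).trans_lt
      (integrableOn_Ioi_rpow_of_lt (a := p - 1) (by linarith) one_pos).lintegral_lt_top
    exact mul_le_of_le_one_right' (ENNReal.ofReal_le_one.2 (by linarith [Real.exp_pos (-t)]))

lemma lmellin_one_sub_exp_neg_neg_one :
    lmellin (fun t => ENNReal.ofReal (1 - Real.exp (-t))) (-1) = ⊤ := by
  have hinv : ∫⁻ t in Set.Ioo (0 : ℝ) 1, ENNReal.ofReal (t ^ (-1 : ℝ)) = ⊤ := by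
    by_contra h
    refine lt_irrefl (-1 : ℝ) ((intervalIntegral.integrableOn_Ioo_rpow_iff one_pos).1
      ⟨by fun_prop, (hasFiniteIntegral_iff_ofReal ?_).2 (lt_top_iff_ne_top.2 h)⟩)
    filter_upwards [self_mem_ae_restrict measurableSet_Ioo] with t ht
      using Real.rpow_nonneg ht.1.le _
  refine top_unique ?_
  calc (⊤ : ℝ≥0∞) = ENNReal.ofReal (1 / 2) * ∫⁻ t in Set.Ioo (0 : ℝ) 1,
        ENNReal.ofReal (t ^ (-1 : ℝ)) := by rw [hinv, ENNReal.mul_top (by norm_num)]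
    _ = ∫⁻ t in Set.Ioo (0 : ℝ) 1, ENNReal.ofReal (1 / 2) * ENNReal.ofReal (t ^ (-1 : ℝ)) :=
        (lintegral_const_mul' _ _ ENNReal.ofReal_ne_top).symm
    _ ≤ ∫⁻ t in Set.Ioo (0 : ℝ) 1,
        ENNReal.ofReal (t ^ (-1 - 1 : ℝ)) * ENNReal.ofReal (1 - Real.exp (-t)) := by
        refine setLIntegral_mono' measurableSet_Ioo fun t ht => ?_
        rw [← ENNReal.ofReal_mul (by norm_num),
          ← ENNReal.ofReal_mul (Real.rpow_nonneg ht.1.le _)]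
        refine ENNReal.ofReal_le_ofReal ?_
        have hexp : 1 / 2 * t ≤ 1 - Real.exp (-t) := by
          have h := inv_anti₀ (by linarith [ht.1]) (Real.add_one_le_exp t)
          have h' : 1 / 2 * t ≤ 1 - (t + 1)⁻¹ := by
            have := ht.1
            field_simp
            nlinarith [ht.2]
          rw [Real.exp_neg]
          linarith
        have := mul_le_mul_of_nonneg_left hexp (Real.rpow_nonneg ht.1.le (-1 - 1))
        rwa [mul_left_comm, ← Real.rpow_add_one ht.1.ne', sub_add_cancel] at this
    _ ≤ lmellin (fun t => ENNReal.ofReal (1 - Real.exp (-t))) (-1) :=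
        lintegral_mono_set Set.Ioo_subset_Ioi_self

end LMellin

lemma differentiableAt_Gamma_of_re_pos {z : ℂ} (hz : 0 < z.re) :
    DifferentiableAt ℂ Complex.Gamma z :=
  Complex.differentiableAt_Gamma z fun m hm => by
    have := m.cast_nonneg (α := ℝ)
    simp [hm] at hz
    linarith

namespace IsPositiveStable

variable {Ω : Type*} [MeasurableSpace Ω] {μ : Measure Ω} {X : Ω → ℝ} {α : ℝ}

lemma integrable_exp (h : IsPositiveStable α X μ) {t : ℝ} (ht : 0 < t) :
    Integrable (fun ω => Real.exp (-(X ω * t))) μ := by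
  refine .of_integral_ne_zero ?_
  simp only [mul_comm (X _), ← neg_mul, h.laplace t ht]
  exact (Real.exp_pos _).ne'

lemma lintegral_exp (h : IsPositiveStable α X μ) {t : ℝ} (ht : 0 < t) :
    ∫⁻ ω, ENNReal.ofReal (Real.exp (-(X ω * t))) ∂μ =
      ENNReal.ofReal (Real.exp (-(t ^ α))) := by
  rw [← ofReal_integral_eq_lintegral_ofReal (h.integrable_exp ht)
    (ae_of_all _ fun _ => (Real.exp_pos _).le), ← h.laplace t ht]
  simp only [mul_comm (X _), neg_mul]

lemma lintegral_one_sub_exp [IsProbabilityMeasure μ] (h : IsPositiveStable α X μ) {t : ℝ}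
    (ht : 0 < t) :
    ∫⁻ ω, ENNReal.ofReal (1 - Real.exp (-(X ω * t))) ∂μ =
      ENNReal.ofReal (1 - Real.exp (-(t ^ α))) := by
  simp only [ENNReal.ofReal_sub _ (Real.exp_pos _).le]
  rw [lintegral_sub' (h.integrable_exp ht).aemeasurable.ennreal_ofReal
    ((h.lintegral_exp ht).trans_ne ENNReal.ofReal_ne_top), h.lintegral_exp ht]
  · simp
  · filter_upwards [h.pos] with ω hω
    simpa using (mul_pos hω ht).le

lemma lintegral_rpow_mul_lmellin [SFinite μ] (h : IsPositiveStable α X μ) (hα : 0 < α)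
    {φ : ℝ → ENNReal} (hφm : Measurable φ)
    (hφ : ∀ t, 0 < t → ∫⁻ ω, φ (X ω * t) ∂μ = φ (t ^ α)) (p : ℝ) :
    ENNReal.ofReal α * ((∫⁻ ω, ENNReal.ofReal (X ω ^ (-p)) ∂μ) * lmellin φ p) =
      lmellin φ (p / α) := by
  rw [GammaMoments.lintegral_rpow_mul_lmellin h.aemeasurable h.pos hφm, lmellin_congr hφ,
    lmellin_comp_rpow φ hα]

lemma lintegral_rpow_neg [SFinite μ] (h : IsPositiveStable α X μ) (hα : 0 < α) {p : ℝ}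
    (hp : 0 < p) :
    ∫⁻ ω, ENNReal.ofReal (X ω ^ (-p)) ∂μ =
      ENNReal.ofReal (Real.Gamma (1 + p / α) / Real.Gamma (1 + p)) := by
  have hmellin := h.lintegral_rpow_mul_lmellin hα
    (φ := fun t => ENNReal.ofReal (Real.exp (-t))) (by fun_prop) (fun _ => h.lintegral_exp) p
  rw [lmellin_exp_neg hp, lmellin_exp_neg (div_pos hp hα), mul_left_comm,
    ← ENNReal.ofReal_mul hα.le, mul_comm,
    ← ENNReal.eq_div_iff (ENNReal.ofReal_pos.2 (by positivity)).ne' ENNReal.ofReal_ne_top,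
    ← ENNReal.ofReal_div_of_pos (by positivity)] at hmellin
  rw [hmellin, add_comm 1 (p / α), add_comm 1 p, Real.Gamma_add_one (div_pos hp hα).ne',
    Real.Gamma_add_one hp.ne']
  congr 1
  field_simp

lemma integrable_rpow_iff_lintegral_ne_top (h : IsPositiveStable α X μ) (s : ℝ) :
    Integrable (fun ω => X ω ^ s) μ ↔ ∫⁻ ω, ENNReal.ofReal (X ω ^ s) ∂μ ≠ ⊤ :=
  (lintegral_ofReal_ne_top_iff_integrable (h.aemeasurable.pow_const _).aestronglyMeasurable
    (h.pos.mono fun _ hω => Real.rpow_nonneg hω.le _)).symm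

variable [IsProbabilityMeasure μ]

lemma lintegral_rpow_mul_lmellin_one_sub_exp_neg (h : IsPositiveStable α X μ) (hα : 0 < α)
    (s : ℝ) :
    ENNReal.ofReal α * ((∫⁻ ω, ENNReal.ofReal (X ω ^ s) ∂μ) *
        lmellin (fun t => ENNReal.ofReal (1 - Real.exp (-t))) (-s)) =
      lmellin (fun t => ENNReal.ofReal (1 - Real.exp (-t))) (-(s / α)) := by
  simpa only [neg_neg, neg_div] using h.lintegral_rpow_mul_lmellin hα
    (φ := fun t => ENNReal.ofReal (1 - Real.exp (-t))) (by fun_prop)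
    (fun _ => h.lintegral_one_sub_exp) (-s)

lemma integrable_rpow (h : IsPositiveStable α X μ) (hα : 0 < α) {s : ℝ} (hs : s < α) :
    Integrable (fun ω => X ω ^ s) μ := by
  rw [h.integrable_rpow_iff_lintegral_ne_top]
  rcases lt_trichotomy s 0 with hs0 | rfl | hs0
  · rw [← neg_neg s, h.lintegral_rpow_neg hα (neg_pos.2 hs0)]
    exact ENNReal.ofReal_ne_top
  · simp
  · intro htop
    have hfinite := lmellin_one_sub_exp_neg_lt_top (neg_lt_neg ((div_lt_one hα).2 hs))
      (neg_neg_of_pos (div_pos hs0 hα))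
    rw [← h.lintegral_rpow_mul_lmellin_one_sub_exp_neg hα, htop,
      ENNReal.top_mul (lmellin_one_sub_exp_neg_ne_zero _),
      ENNReal.mul_top (ENNReal.ofReal_pos.2 hα).ne'] at hfinite
    exact hfinite.false

lemma not_integrable_rpow_self (h : IsPositiveStable α X μ) (hα : 0 < α) (hα1 : α < 1) :
    ¬ Integrable (fun ω => X ω ^ α) μ := by
  rw [h.integrable_rpow_iff_lintegral_ne_top]
  intro hfinite
  have htop := h.lintegral_rpow_mul_lmellin_one_sub_exp_neg hα α
  rw [div_self hα.ne', lmellin_one_sub_exp_neg_neg_one] at htop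
  exact ENNReal.mul_ne_top ENNReal.ofReal_ne_top (ENNReal.mul_ne_top hfinite
    (lmellin_one_sub_exp_neg_lt_top (by linarith) (neg_neg_of_pos hα)).ne) htop

lemma integrable_rpow_iff (h : IsPositiveStable α X μ) (hα : 0 < α) (hα1 : α < 1) (s : ℝ) :
    Integrable (fun ω => X ω ^ s) μ ↔ s < α := by
  refine ⟨fun hs => ?_, h.integrable_rpow hα⟩
  by_contra! hαs
  refine h.not_integrable_rpow_self hα hα1 ?_
  rw [← mem_integrableExpSet_log_iff h.pos] at hs ⊢
  exact convex_integrableExpSet.ordConnected.out (by simp [integrableExpSet]) hs ⟨hα.le, hαs⟩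

lemma hasMoment (h : IsPositiveStable α X μ) (hα : 0 < α) {s : ℂ} (hs : s.re < α) :
    HasMoment μ X s (Complex.Gamma (1 - s / α) / Complex.Gamma (1 - s)) := by
  refine hasMoment_of_integral_rpow_eq
    (f := fun s => Complex.Gamma (1 - s / α) / Complex.Gamma (1 - s)) h.aemeasurable h.pos
    (isOpen_Iio (a := α)) Set.ordConnected_Iio (fun s hs => h.integrable_rpow hα hs) ?_
    (c := -1) (d := 0) (by norm_num) (fun x hx => hx.2.trans hα) ?_ hs
  · intro z (hz : z.re < α)
    have hpos : 0 < (1 - z / α : ℂ).re := by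
      simpa [Complex.div_ofReal_re] using (div_lt_one hα).2 hz
    have hnum : DifferentiableAt ℂ (fun s : ℂ => Complex.Gamma (1 - s / α)) z :=
      (differentiableAt_Gamma_of_re_pos hpos).comp z (by fun_prop)
    have hden : DifferentiableAt ℂ (fun s : ℂ => (Complex.Gamma (1 - s))⁻¹) z :=
      (Complex.differentiable_one_div_Gamma _).comp z (by fun_prop)
    simp only [div_eq_mul_inv (Complex.Gamma _)]
    exact (hnum.mul hden).differentiableWithinAt
  · intro r _ hr
    have hlintegral := h.lintegral_rpow_neg hα (neg_pos.2 hr)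
    rw [neg_neg] at hlintegral
    rw [integral_eq_lintegral_of_nonneg_ae (h.pos.mono fun _ hω => Real.rpow_nonneg hω.le _)
      (h.aemeasurable.pow_const _).aestronglyMeasurable, hlintegral, ENNReal.toReal_ofReal,
      Complex.ofReal_div, ← Complex.Gamma_ofReal, ← Complex.Gamma_ofReal]
    · push_cast
      ring_nf
    · have hquot : 0 < -r / α := div_pos (neg_pos.2 hr) hα
      exact div_nonneg (Real.Gamma_nonneg_of_nonneg (by linarith))
        (Real.Gamma_nonneg_of_nonneg (by linarith))

lemma integral_rpow (h : IsPositiveStable α X μ) (hα : 0 < α) {s : ℝ} (hs : s < α) :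
    ∫ ω, X ω ^ s ∂μ = Real.Gamma (1 - s / α) / Real.Gamma (1 - s) := by
  have hmoment := (h.hasMoment hα (s := s) (by simpa using hs)).2
  rw [cmoment_ofReal h.pos] at hmoment
  apply Complex.ofReal_injective
  rw [hmoment, Complex.ofReal_div, ← Complex.Gamma_ofReal, ← Complex.Gamma_ofReal]
  push_cast
  rfl

end IsPositiveStable

section MittagLeffler

lemma rpow_mul_exp_neg_le_Gamma {R x : ℝ} (hR : 0 ≤ R) (hx : 0 ≤ x) :
    R ^ x * Real.exp (-R) ≤ Real.Gamma (1 + x) := by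
  have hGamma : IntegrableOn (fun t : ℝ => Real.exp (-t) * t ^ (1 + x - 1)) (Set.Ioi 0) :=
    Real.GammaIntegral_convergent (by linarith)
  rw [Real.Gamma_eq_integral (by linarith), ← integral_exp_neg_Ioi R, ← integral_const_mul]
  calc ∫ t in Set.Ioi R, R ^ x * Real.exp (-t)
      ≤ ∫ t in Set.Ioi R, Real.exp (-t) * t ^ (1 + x - 1) := by
        refine setIntegral_mono_on ((integrableOn_exp_neg_Ioi R).const_mul _)
          (hGamma.mono_set (Set.Ioi_subset_Ioi hR)) measurableSet_Ioi fun t (ht : R < t) => ?_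
        rw [mul_comm, add_sub_cancel_left]
        gcongr
    _ ≤ ∫ t in Set.Ioi (0 : ℝ), Real.exp (-t) * t ^ (1 + x - 1) := by
        refine setIntegral_mono_set hGamma ?_ (Set.Ioi_subset_Ioi hR).eventuallyLE
        filter_upwards [self_mem_ae_restrict measurableSet_Ioi] with t (ht : 0 < t)
        positivity

lemma summable_pow_div_Gamma {α : ℝ} (hα : 0 < α) {r : ℝ} (hr : 0 ≤ r) :
    Summable fun n : ℕ => r ^ n / Real.Gamma (1 + α * n) := by
  set R : ℝ := (r + 1) ^ (1 / α)
  have hgeom : Summable fun n : ℕ => Real.exp R * (r / (r + 1)) ^ n :=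
    (summable_geometric_of_lt_one (by positivity)
      ((div_lt_one (by linarith)).2 (by linarith))).mul_left _
  refine hgeom.of_nonneg_of_le (fun n => ?_) fun n => ?_
  · exact div_nonneg (by positivity) (Real.Gamma_pos_of_pos (by positivity)).le
  · have hRn : R ^ (α * n) = (r + 1) ^ n := by
      rw [← Real.rpow_mul (by linarith), ← mul_assoc, one_div_mul_cancel hα.ne', one_mul,
        Real.rpow_natCast]
    have hΓ := rpow_mul_exp_neg_le_Gamma (R := R) (x := α * n) (by positivity) (by positivity)
    rw [hRn] at hΓ
    calc r ^ n / Real.Gamma (1 + α * n) ≤ r ^ n / ((r + 1) ^ n * Real.exp (-R)) := by gcongr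
      _ = Real.exp R * (r / (r + 1)) ^ n := by
        rw [Real.exp_neg, div_pow]
        field_simp

variable {Ω : Type*} [MeasurableSpace Ω] {μ : Measure Ω} {X : Ω → ℝ}

lemma hasSum_integral_exp_mul (hX : ∀ᵐ ω ∂μ, 0 ≤ X ω)
    (hint : ∀ n : ℕ, Integrable (fun ω => X ω ^ n) μ) {t : ℝ}
    (hsum : Summable fun n : ℕ => |t| ^ n * ((∫ ω, X ω ^ n ∂μ) / n.factorial)) :
    HasSum (fun n : ℕ => t ^ n * ((∫ ω, X ω ^ n ∂μ) / n.factorial))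
      (∫ ω, Real.exp (t * X ω) ∂μ) := by
  have hterm (r : ℝ) (n : ℕ) : ∫ ω, (r * X ω) ^ n / n.factorial ∂μ =
      r ^ n * ((∫ ω, X ω ^ n ∂μ) / n.factorial) := by
    simp only [mul_pow, integral_div, integral_const_mul, mul_div_assoc]
  have hnorm (n : ℕ) : ∫ ω, ‖(t * X ω) ^ n / n.factorial‖ ∂μ =
      |t| ^ n * ((∫ ω, X ω ^ n ∂μ) / n.factorial) := by
    rw [← hterm]
    refine integral_congr_ae (hX.mono fun ω hω => ?_)
    simp only [norm_div, norm_pow, norm_mul, Real.norm_eq_abs, abs_of_nonneg hω, Nat.abs_cast]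
  have hexp (ω : Ω) : ∑' n : ℕ, (t * X ω) ^ n / n.factorial = Real.exp (t * X ω) := by
    rw [Real.exp_eq_exp_ℝ, NormedSpace.exp_eq_tsum_div]
  have h := hasSum_integral_of_summable_integral_norm
    (F := fun (n : ℕ) ω => (t * X ω) ^ n / n.factorial) (μ := μ)
    (fun n => by simpa only [mul_pow] using ((hint n).const_mul _).div_const _)
    (hsum.congr fun n => (hnorm n).symm)
  simpa only [hterm, hexp] using h

lemma integrable_exp_mul_of_summable [IsProbabilityMeasure μ] (hXm : AEMeasurable X μ)
    (hX : ∀ᵐ ω ∂μ, 0 ≤ X ω) (hint : ∀ n : ℕ, Integrable (fun ω => X ω ^ n) μ) {t : ℝ}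
    (hsum : Summable fun n : ℕ => |t| ^ n * ((∫ ω, X ω ^ n ∂μ) / n.factorial)) :
    Integrable (fun ω => Real.exp (t * X ω)) μ := by
  rcases le_total t 0 with ht | ht
  · refine .of_bound (Real.measurable_exp.comp_aemeasurable (hXm.const_mul t)).aestronglyMeasurable
      1 (hX.mono fun ω hω => ?_)
    rw [Real.norm_of_nonneg (Real.exp_pos _).le, Real.exp_le_one_iff]
    exact mul_nonpos_of_nonpos_of_nonneg ht hω
  · have hmgf := hasSum_integral_exp_mul hX hint hsum
    have hnonneg (n : ℕ) : 0 ≤ t ^ n * ((∫ ω, X ω ^ n ∂μ) / n.factorial) := by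
      have := integral_nonneg_of_ae (hX.mono fun ω hω => pow_nonneg hω n)
      positivity
    have hone : 1 ≤ ∫ ω, Real.exp (t * X ω) ∂μ := by
      simpa using le_hasSum hmgf 0 fun n _ => hnonneg n
    exact .of_integral_ne_zero (by linarith)

lemma IsPositiveStable.isMittagLeffler [IsProbabilityMeasure μ] {α : ℝ}
    (h : IsPositiveStable α X μ) (hα : 0 < α) : IsMittagLeffler α (fun ω => X ω ^ (-α)) μ := by
  have hm : AEMeasurable (fun ω => X ω ^ (-α)) μ := h.aemeasurable.pow_const _
  have hpos : ∀ᵐ ω ∂μ, 0 < X ω ^ (-α) := ae_pos_rpow h.pos _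
  have hexponent (n : ℕ) : -(α * n) < α := by
    have : 0 ≤ α * n := by positivity
    linarith
  have hpow (n : ℕ) : ∀ᵐ ω ∂μ, (X ω ^ (-α)) ^ n = X ω ^ (-(α * n)) := h.pos.mono fun ω hω => by
    rw [← Real.rpow_natCast, ← Real.rpow_mul hω.le, neg_mul]
  have hint (n : ℕ) : Integrable (fun ω => (X ω ^ (-α)) ^ n) μ :=
    (integrable_congr (hpow n)).2 (h.integrable_rpow hα (hexponent n))
  have hmoment (n : ℕ) :
      (∫ ω, (X ω ^ (-α)) ^ n ∂μ) / n.factorial = (Real.Gamma (1 + α * n))⁻¹ := by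
    rw [integral_congr_ae (hpow n), h.integral_rpow hα (hexponent n), neg_div,
      mul_div_cancel_left₀ _ hα.ne', sub_neg_eq_add, sub_neg_eq_add, add_comm 1 (n : ℝ),
      Real.Gamma_nat_eq_factorial, div_div_cancel_left' (by positivity)]
  have hsum (t : ℝ) :
      Summable fun n : ℕ => |t| ^ n * ((∫ ω, (X ω ^ (-α)) ^ n ∂μ) / n.factorial) := by
    simpa only [hmoment, ← div_eq_mul_inv] using summable_pow_div_Gamma hα (abs_nonneg t)
  refine ⟨hm, hpos, fun t => integrable_exp_mul_of_summable hm (hpos.mono fun _ => le_of_lt) hint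
    (hsum t), fun t => ?_⟩
  simpa only [hmoment, ← div_eq_mul_inv] using
    hasSum_integral_exp_mul (hpos.mono fun _ => le_of_lt) hint (hsum t)

end MittagLeffler

section CauchyKernel

open Set

lemma lmellin_exp_neg_mul {c p : ℝ} (hc : 0 < c) (hp : 0 < p) :
    lmellin (fun t => ENNReal.ofReal (Real.exp (-(c * t)))) p =
      ENNReal.ofReal (c ^ (-p) * Real.Gamma p) := by
  rw [lmellin_comp_mul_left (fun t => ENNReal.ofReal (Real.exp (-t))) hc, lmellin_exp_neg hp,
    ENNReal.ofReal_mul (by positivity)]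

lemma lmellin_add_inv {c p : ℝ} (hc : 0 < c) (hp : 0 < p) (hp1 : p < 1) :
    lmellin (fun t => ENNReal.ofReal (t + c)⁻¹) p =
      ENNReal.ofReal (Real.Gamma p * Real.Gamma (1 - p) * c ^ (p - 1)) := by
  set w : ℝ → ENNReal := fun x => ENNReal.ofReal (Real.exp (-(c * x)))
  set ν := (volume.restrict (Set.Ioi (0 : ℝ))).withDensity w
  have hν {g : ℝ → ENNReal} (hg : Measurable g) :
      ∫⁻ x, g x ∂ν = ∫⁻ x in Set.Ioi (0 : ℝ), w x * g x :=
    lintegral_withDensity_eq_lintegral_mul _ (by fun_prop) hg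
  have hpos : ∀ᵐ x ∂ν, 0 < id x :=
    (withDensity_absolutelyContinuous _ _).ae_le (self_mem_ae_restrict measurableSet_Ioi)
  have hmoment : ∫⁻ x, ENNReal.ofReal (id x ^ (-p)) ∂ν =
      ENNReal.ofReal (c ^ (p - 1) * Real.Gamma (1 - p)) := by
    rw [← neg_sub 1 p, ← lmellin_exp_neg_mul hc (sub_pos.2 hp1), lmellin,
      hν (by fun_prop)]
    simp only [id, w, mul_comm, sub_sub_cancel_left]
  have hlaplace (t : ℝ) (ht : 0 < t) :
      ∫⁻ x, ENNReal.ofReal (Real.exp (-(id x * t))) ∂ν = ENNReal.ofReal (t + c)⁻¹ := by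
    have h := lmellin_exp_neg_mul (add_pos ht hc) one_pos
    rw [Real.Gamma_one, mul_one, Real.rpow_neg_one] at h
    rw [← h, lmellin, hν (by fun_prop)]
    refine lintegral_congr fun x => ?_
    rw [← ENNReal.ofReal_mul (Real.exp_pos _).le, ← Real.exp_add, sub_self, Real.rpow_zero,
      ENNReal.ofReal_one, one_mul, id]
    ring_nf
  rw [← lmellin_congr hlaplace, ← lintegral_rpow_mul_lmellin aemeasurable_id hpos
    (φ := fun t => ENNReal.ofReal (Real.exp (-t))) (by fun_prop) p, hmoment, lmellin_exp_neg hp,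
    ← ENNReal.ofReal_mul (mul_nonneg (by positivity) (Real.Gamma_pos_of_pos (sub_pos.2 hp1)).le)]
  ring_nf

lemma ofReal_add_mem_slitPlane {x : ℝ} (hx : 0 ≤ x) {z : ℂ} (hz : z ∈ Complex.slitPlane) :
    (x : ℂ) + z ∈ Complex.slitPlane := by
  rw [Complex.mem_slitPlane_iff] at hz ⊢
  exact hz.imp (fun h => by simpa using add_pos_of_nonneg_of_pos hx h) fun h => by simpa using h

lemma exists_norm_add_inv_le {z₀ : ℂ} (hz₀ : z₀ ∈ Complex.slitPlane) :
    ∃ ε > 0, ∃ C, ∀ z ∈ Metric.ball z₀ ε, z ∈ Complex.slitPlane ∧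
      ∀ x : ℝ, 0 ≤ x → ‖((x : ℂ) + z)⁻¹‖ ≤ C * (x + 1)⁻¹ := by
  obtain ⟨ε, hε, hball⟩ := Metric.isOpen_iff.1 Complex.isOpen_slitPlane z₀ hz₀
  refine ⟨ε / 2, half_pos hε, 1 + (‖z₀‖ + ε / 2 + 1) / (ε / 2), fun z hz => ?_⟩
  refine ⟨hball (Metric.ball_subset_ball (half_le_self hε.le) hz), fun x hx => ?_⟩
  have hdist : ε / 2 ≤ ‖(x : ℂ) + z‖ := by
    by_contra! hlt
    have hmem : (-x : ℂ) ∈ Metric.ball z₀ ε := by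
      rw [Metric.mem_ball, dist_eq_norm] at hz ⊢
      calc ‖-(x : ℂ) - z₀‖ = ‖(z - z₀) - (x + z)‖ := by ring_nf
        _ ≤ ‖z - z₀‖ + ‖(x : ℂ) + z‖ := norm_sub_le _ _
        _ < ε := by linarith
    exact Complex.slitPlane_ne_zero (ofReal_add_mem_slitPlane hx (hball hmem)) (by ring)
  have hdist' : x + 1 ≤ ‖(x : ℂ) + z‖ + (‖z‖ + 1) := by
    have h := norm_sub_le ((x : ℂ) + z) z
    rw [add_sub_cancel_right, Complex.norm_of_nonneg hx] at h
    linarith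
  have hz' : ‖z‖ ≤ ‖z₀‖ + ε / 2 := by
    have h := norm_le_norm_add_norm_sub' z z₀
    rw [Metric.mem_ball, dist_eq_norm] at hz
    linarith
  have hratio : ‖z₀‖ + ε / 2 + 1 ≤ (‖z₀‖ + ε / 2 + 1) / (ε / 2) * ‖(x : ℂ) + z‖ := by
    rw [div_mul_eq_mul_div, le_div_iff₀ (half_pos hε)]
    gcongr
  rw [norm_inv, ← div_eq_mul_inv, inv_le_iff_one_le_mul₀ ((half_pos hε).trans_le hdist),
    div_mul_eq_mul_div, one_le_div (by linarith)]
  linarith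

lemma differentiableOn_integral_add_inv {ν : Measure ℝ} (hν : ∀ᵐ x ∂ν, 0 ≤ x)
    (hint : Integrable (fun x : ℝ => (x + 1)⁻¹) ν) :
    DifferentiableOn ℂ (fun z : ℂ => ∫ x : ℝ, ((x : ℂ) + z)⁻¹ ∂ν) Complex.slitPlane := by
  intro z₀ hz₀
  obtain ⟨ε, hε, C, hbound⟩ := exists_norm_add_inv_le hz₀
  have hm (z : ℂ) : Measurable fun x : ℝ => ((x : ℂ) + z)⁻¹ := by fun_prop
  refine (hasDerivAt_integral_of_dominated_loc_of_deriv_le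
    (F' := fun z x => -(((x : ℂ) + z)⁻¹) ^ 2) (bound := fun x => C ^ 2 * (x + 1)⁻¹)
    (Metric.ball_mem_nhds z₀ hε) (.of_forall fun z => (hm z).aestronglyMeasurable)
    ?_ ?_ ?_ (hint.const_mul _) ?_).2.differentiableAt.differentiableWithinAt
  · refine (hint.const_mul C).mono' (hm z₀).aestronglyMeasurable (hν.mono fun x hx => ?_)
    exact (hbound z₀ (Metric.mem_ball_self hε)).2 x hx
  · exact ((hm z₀).pow_const 2).neg.aestronglyMeasurable
  · refine hν.mono fun x hx z hz => ?_
    have hone : (x + 1)⁻¹ ≤ 1 := inv_le_one_of_one_le₀ (by linarith)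
    calc ‖-(((x : ℂ) + z)⁻¹) ^ 2‖ = ‖((x : ℂ) + z)⁻¹‖ ^ 2 := by rw [norm_neg, norm_pow]
      _ ≤ (C * (x + 1)⁻¹) ^ 2 := by gcongr; exact (hbound z hz).2 x hx
      _ = C ^ 2 * (x + 1)⁻¹ * (x + 1)⁻¹ := by ring
      _ ≤ C ^ 2 * (x + 1)⁻¹ * 1 := by gcongr
      _ = C ^ 2 * (x + 1)⁻¹ := mul_one _
  · refine hν.mono fun x hx z hz => ?_
    have hne := Complex.slitPlane_ne_zero (ofReal_add_mem_slitPlane hx (hbound z hz).1)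
    exact (((hasDerivAt_id z).const_add (x : ℂ)).fun_inv hne).congr_deriv (by simp [neg_div])

lemma integral_rpow_mul_add_inv {s c : ℝ} (hs : -1 < s) (hs0 : s < 0) (hc : 0 < c) :
    ∫ x in Ioi (0 : ℝ), x ^ s * (x + c)⁻¹ = Real.Gamma (1 + s) * Real.Gamma (-s) * c ^ s := by
  have hnonneg : 0 ≤ᵐ[volume.restrict (Ioi (0 : ℝ))] fun x : ℝ => x ^ s * (x + c)⁻¹ :=
    (ae_restrict_mem measurableSet_Ioi).mono fun x (hx : 0 < x) => by positivity
  have hΓ := Real.Gamma_pos_of_pos (neg_pos.2 hs0)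
  have hΓ' := Real.Gamma_pos_of_pos (neg_lt_iff_pos_add'.1 hs)
  have h := lmellin_add_inv hc (neg_lt_iff_pos_add'.1 hs) (add_lt_iff_neg_left.2 hs0)
  rw [lmellin, add_sub_cancel_left, sub_add_cancel_left] at h
  rw [integral_eq_lintegral_of_nonneg_ae hnonneg (by fun_prop), ← ENNReal.toReal_ofReal
    (by positivity : 0 ≤ Real.Gamma (1 + s) * Real.Gamma (-s) * c ^ s), ← h]
  congr 1
  exact setLIntegral_congr_fun measurableSet_Ioi fun x (hx : 0 < x) =>
    ENNReal.ofReal_mul (by positivity)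

lemma integrableOn_rpow_mul_add_inv {s c : ℝ} (hs : -1 < s) (hs0 : s < 0) (hc : 0 < c) :
    IntegrableOn (fun x : ℝ => x ^ s * (x + c)⁻¹) (Ioi 0) := by
  refine .of_integral_ne_zero ?_
  rw [integral_rpow_mul_add_inv hs hs0 hc]
  have hΓ := Real.Gamma_pos_of_pos (neg_pos.2 hs0)
  have hΓ' := Real.Gamma_pos_of_pos (neg_lt_iff_pos_add'.1 hs)
  positivity

lemma integrableOn_ofReal_rpow_mul_add_inv {s : ℝ} (hs : -1 < s) (hs0 : s < 0) {z : ℂ}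
    (hz : z ∈ Complex.slitPlane) :
    IntegrableOn (fun x : ℝ => ((x ^ s : ℝ) : ℂ) * ((x : ℂ) + z)⁻¹) (Ioi 0) := by
  obtain ⟨ε, hε, C, hbound⟩ := exists_norm_add_inv_le hz
  refine ((integrableOn_rpow_mul_add_inv hs hs0 one_pos).const_mul C).mono' (by fun_prop)
    ((ae_restrict_mem measurableSet_Ioi).mono fun x (hx : 0 < x) => ?_)
  rw [norm_mul, Complex.norm_real, Real.norm_of_nonneg (by positivity), mul_left_comm]
  gcongr
  exact (hbound z (Metric.mem_ball_self hε)).2 x hx.le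

lemma integral_ofReal_rpow_mul_add_inv {s : ℝ} (hs : -1 < s) (hs0 : s < 0) {z : ℂ}
    (hz : z ∈ Complex.slitPlane) :
    ∫ x in Ioi (0 : ℝ), ((x ^ s : ℝ) : ℂ) * ((x : ℂ) + z)⁻¹ =
      Real.Gamma (1 + s) * Real.Gamma (-s) * z ^ (s : ℂ) := by
  have hdensity : Measurable fun x : ℝ => Real.toNNReal (x ^ s) := by fun_prop
  set ν := (volume.restrict (Ioi (0 : ℝ))).withDensity fun x => Real.toNNReal (x ^ s)
  have hν : ∀ᵐ x ∂ν, 0 ≤ x := (withDensity_absolutelyContinuous _ _).ae_le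
    ((ae_restrict_mem measurableSet_Ioi).mono fun x (hx : 0 < x) => hx.le)
  have hint : Integrable (fun x : ℝ => (x + 1)⁻¹) ν :=
    (integrable_withDensity_iff_integrable_smul hdensity).2 <|
      (integrableOn_rpow_mul_add_inv hs hs0 one_pos).congr_fun
        (fun x (hx : 0 < x) => by
          simp [NNReal.smul_def, Real.coe_toNNReal _ (Real.rpow_nonneg hx.le s)])
        measurableSet_Ioi
  have hstieltjes (w : ℂ) : ∫ x, ((x : ℂ) + w)⁻¹ ∂ν =
      ∫ x in Ioi (0 : ℝ), ((x ^ s : ℝ) : ℂ) * ((x : ℂ) + w)⁻¹ := by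
    rw [integral_withDensity_eq_integral_smul hdensity]
    exact setIntegral_congr_fun measurableSet_Ioi fun x (hx : 0 < x) => by
      simp [NNReal.smul_def, Real.coe_toNNReal _ (Real.rpow_nonneg hx.le s)]
  rw [← hstieltjes]
  refine eqOn_of_eventually_eq_ofReal (m := 1) Complex.isOpen_slitPlane
    (Complex.starConvex_one_slitPlane.isPathConnected
      Complex.one_mem_slitPlane).isConnected.isPreconnected
    (differentiableOn_integral_add_inv hν hint)
    (g := fun w => Real.Gamma (1 + s) * Real.Gamma (-s) * w ^ (s : ℂ))
    (fun w hw => ((differentiableAt_id.cpow_const hw).const_mul _).differentiableWithinAt)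
    Complex.one_mem_slitPlane ?_ hz
  filter_upwards [Ioi_mem_nhds one_pos] with c (hc : 0 < c)
  simp only [hstieltjes]
  simp only [← Complex.ofReal_cpow hc.le, ← Complex.ofReal_add, ← Complex.ofReal_inv,
    ← Complex.ofReal_mul, integral_complex_ofReal, integral_rpow_mul_add_inv hs hs0 hc]

/-- The function `1 / (x ^ 2 + 2 * cos θ * x + 1)`, which for `θ = π α` is proportional to the
density of `L_α ^ α`. -/
noncomputable def lampertiKernel (θ x : ℝ) : ℝ :=
  1 / (x ^ 2 + 2 * Real.cos θ * x + 1)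

lemma lampertiKernel_pos {θ : ℝ} (hθ : θ ∈ Ioo 0 Real.pi) (x : ℝ) : 0 < lampertiKernel θ x := by
  have hsin := Real.sin_pos_of_mem_Ioo hθ
  refine one_div_pos.2 ?_
  nlinarith [Real.sin_sq_add_cos_sq θ, sq_nonneg (x + Real.cos θ), pow_pos hsin 2]

lemma im_ofReal_add_exp_neg_inv (θ x : ℝ) :
    ((x : ℂ) + Complex.exp ((-θ : ℝ) * Complex.I))⁻¹.im = Real.sin θ * lampertiKernel θ x := by
  have hnormSq : Complex.normSq (x + Complex.exp ((-θ : ℝ) * Complex.I)) =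
      x ^ 2 + 2 * Real.cos θ * x + 1 := by
    rw [Complex.normSq_apply, Complex.add_re, Complex.add_im, Complex.exp_ofReal_mul_I_re,
      Complex.exp_ofReal_mul_I_im, Complex.ofReal_re, Complex.ofReal_im, Real.cos_neg, Real.sin_neg]
    linear_combination Real.sin_sq_add_cos_sq θ
  rw [Complex.inv_im, hnormSq, Complex.add_im, Complex.exp_ofReal_mul_I_im, Complex.ofReal_im,
    Real.sin_neg, lampertiKernel]
  ring

lemma exp_neg_mul_I_cpow {θ : ℝ} (hθ : θ ∈ Ioo 0 Real.pi) (s : ℝ) :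
    Complex.exp ((-θ : ℝ) * Complex.I) ^ (s : ℂ) =
      Complex.exp ((-(θ * s) : ℝ) * Complex.I) := by
  rw [Complex.cpow_def_of_ne_zero (Complex.exp_ne_zero _), Complex.log_exp]
  · push_cast; ring_nf
  · simpa using hθ.2
  · simpa using (neg_neg_of_pos hθ.1).le.trans Real.pi_pos.le

lemma exp_neg_mul_I_mem_slitPlane {θ : ℝ} (hθ : θ ∈ Ioo 0 Real.pi) :
    Complex.exp ((-θ : ℝ) * Complex.I) ∈ Complex.slitPlane := by
  refine Complex.mem_slitPlane_iff.2 (.inr ?_)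
  rw [Complex.exp_ofReal_mul_I_im, Real.sin_neg]
  exact (neg_neg_of_pos (Real.sin_pos_of_mem_Ioo hθ)).ne

lemma integrableOn_rpow_mul_lampertiKernel {θ : ℝ} (hθ : θ ∈ Ioo 0 Real.pi) {s : ℝ} (hs : -1 < s)
    (hs1 : s < 1) : IntegrableOn (fun x : ℝ => x ^ s * lampertiKernel θ x) (Ioi 0) := by
  have hcont : Continuous (lampertiKernel θ) :=
    continuous_const.div (by fun_prop) fun x => (one_div_pos.1 (lampertiKernel_pos hθ x)).ne'
  have htop : lampertiKernel θ =O[Filter.atTop] fun x : ℝ => x ^ (-2 : ℝ) := by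
    refine .of_bound ((Real.sin θ ^ 2)⁻¹) ?_
    filter_upwards [Filter.eventually_gt_atTop 0] with x hx
    have hsin := Real.sin_pos_of_mem_Ioo hθ
    rw [Real.norm_of_nonneg (lampertiKernel_pos hθ x).le, Real.norm_of_nonneg (by positivity),
      Real.rpow_neg hx.le, Real.rpow_two, ← mul_inv, lampertiKernel, one_div]
    gcongr
    nlinarith [Real.sin_sq_add_cos_sq θ, sq_nonneg (Real.cos θ * x + 1)]
  have hbot : lampertiKernel θ =O[nhdsWithin 0 (Ioi 0)] fun x : ℝ => x ^ (-0 : ℝ) := by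
    simp only [neg_zero, Real.rpow_zero]
    exact (hcont.tendsto 0).isBigO_one ℝ |>.mono nhdsWithin_le_nhds
  simpa only [add_sub_cancel_right] using mellin_convergent_of_isBigO_scalar (s := s + 1)
    (hcont.locallyIntegrable.locallyIntegrableOn _) htop (by linarith) hbot (by linarith)

lemma integral_rpow_mul_lampertiKernel {θ : ℝ} (hθ : θ ∈ Ioo 0 Real.pi) {s : ℝ} (hs : -1 < s)
    (hs0 : s < 0) :
    ∫ x in Ioi (0 : ℝ), x ^ s * lampertiKernel θ x =
      Real.pi * Real.sin (θ * s) / (Real.sin θ * Real.sin (Real.pi * s)) := by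
  have hz := exp_neg_mul_I_mem_slitPlane hθ
  have him := integral_im (integrableOn_ofReal_rpow_mul_add_inv hs hs0 hz)
  simp only [RCLike.im_to_complex, Complex.im_ofReal_mul, im_ofReal_add_exp_neg_inv] at him
  rw [integral_ofReal_rpow_mul_add_inv hs hs0 hz, exp_neg_mul_I_cpow hθ, ← Complex.ofReal_mul,
    Complex.im_ofReal_mul, Complex.exp_ofReal_mul_I_im] at him
  have hsin := Real.sin_pos_of_mem_Ioo hθ
  have hreflection :
      Real.Gamma (1 + s) * Real.Gamma (-s) = -(Real.pi / Real.sin (Real.pi * s)) := by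
    have h := Real.Gamma_mul_Gamma_one_sub (1 + s)
    rw [sub_add_cancel_left, mul_add, mul_one, add_comm Real.pi, Real.sin_add_pi, div_neg] at h
    exact h
  simp only [mul_left_comm _ (Real.sin θ), integral_const_mul, Real.sin_neg, hreflection] at him
  rw [mul_comm, ← eq_div_iff hsin.ne'] at him
  rw [him]
  field_simp

end CauchyKernel

section Density

open Set

variable {Ω : Type*} [MeasurableSpace Ω] {μ : Measure Ω} {X : Ω → ℝ} {f : ℝ → ℝ}

lemma hasPosDensity_of_integral_rpow_eq [IsFiniteMeasure μ] (hXm : AEMeasurable X μ)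
    (hX : ∀ᵐ ω ∂μ, 0 < X ω) (hf : Measurable f) (hf0 : ∀ x, 0 < x → 0 ≤ f x) {I : Set ℝ}
    (hI : IsOpen I) (hI' : I.OrdConnected) (hI0 : 0 ∈ I)
    (hXi : ∀ s ∈ I, Integrable (fun ω => X ω ^ s) μ)
    (hfi : ∀ s ∈ I, IntegrableOn (fun x : ℝ => x ^ s * f x) (Ioi 0)) {c d : ℝ} (hcd : c < d)
    (hsub : Ioo c d ⊆ I)
    (h : ∀ s, c < s → s < d → ∫ ω, X ω ^ s ∂μ = ∫ x in Ioi (0 : ℝ), x ^ s * f x) :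
    HasPosDensity μ X f := by
  have hdensity : Measurable fun x => (f x).toNNReal := by fun_prop
  have hsmul (s x : ℝ) (hx : x ∈ Ioi (0 : ℝ)) : x ^ s * f x = (f x).toNNReal • x ^ s := by
    rw [NNReal.smul_def, Real.coe_toNNReal _ (hf0 x hx), smul_eq_mul, mul_comm]
  have hfin : IsFiniteMeasure ((volume.restrict (Ioi (0 : ℝ))).withDensity fun x =>
      ((f x).toNNReal : ENNReal)) :=
    isFiniteMeasure_withDensity_ofReal (by simpa using (hfi 0 hI0).2)
  have hpos : ∀ᵐ x ∂((volume.restrict (Ioi (0 : ℝ))).withDensity fun x =>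
      ((f x).toNNReal : ENNReal)), 0 < id x :=
    (withDensity_absolutelyContinuous _ _).ae_le (ae_restrict_mem measurableSet_Ioi)
  refine ⟨hXm, (map_eq_map_of_integral_rpow_eq hXm hX aemeasurable_id hpos hI hI' hI0 hXi
    (fun s hs => ?_) hcd hsub fun s hcs hsd => ?_).trans Measure.map_id⟩
  · exact (integrable_withDensity_iff_integrable_smul hdensity).2
      ((hfi s hs).congr_fun (hsmul s) measurableSet_Ioi)
  · rw [h s hcs hsd, integral_withDensity_eq_integral_smul hdensity]
    exact setIntegral_congr_fun measurableSet_Ioi (hsmul s)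

lemma HasPosDensity.of_rpow {q : ℝ} (hq : 0 < q) (hXm : AEMeasurable X μ)
    (hX : ∀ᵐ ω ∂μ, 0 < X ω) (hf : Measurable f) (h : HasPosDensity μ (fun ω => X ω ^ q) f) :
    HasPosDensity μ X fun x => q * x ^ (q - 1) * f (x ^ q) := by
  refine ⟨hXm, Measure.ext_of_lintegral _ fun φ hφ => ?_⟩
  have hroot : Measurable fun y : ℝ => φ (y ^ q⁻¹) := by fun_prop
  calc ∫⁻ x, φ x ∂(μ.map X) = ∫⁻ ω, φ ((X ω ^ q) ^ q⁻¹) ∂μ := by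
        rw [lintegral_map' hφ.aemeasurable hXm]
        exact lintegral_congr_ae <| hX.mono fun ω hω => by
          simp only [Real.rpow_rpow_inv hω.le hq.ne']
    _ = ∫⁻ y in Ioi (0 : ℝ), ENNReal.ofReal (f y) * φ (y ^ q⁻¹) := by
        rw [← lintegral_map' hroot.aemeasurable h.aemeasurable, h.map_eq,
          lintegral_withDensity_eq_lintegral_mul _ (by fun_prop) hroot]
        rfl
    _ = ∫⁻ x in Ioi (0 : ℝ), ENNReal.ofReal (q * x ^ (q - 1) * f (x ^ q)) * φ x := by
        rw [← lintegral_comp_rpow_Ioi _ hq]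
        refine setLIntegral_congr_fun measurableSet_Ioi fun x (hx : 0 < x) => ?_
        simp only [Real.rpow_rpow_inv hx.le hq.ne', ← mul_assoc]
        rw [← ENNReal.ofReal_mul (by positivity)]
    _ = ∫⁻ x, φ x ∂((volume.restrict (Ioi 0)).withDensity fun x =>
          ENNReal.ofReal (q * x ^ (q - 1) * f (x ^ q))) := by
        rw [lintegral_withDensity_eq_lintegral_mul _ (by fun_prop) hφ]
        rfl

lemma lintegral_eq_two_mul_setLIntegral_Ioi_of_even {g : ℝ → ENNReal} (hg : ∀ x, g (-x) = g x) :
    ∫⁻ x, g x = 2 * ∫⁻ x in Ioi (0 : ℝ), g x := by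
  have hIic : ∫⁻ x in Iic (0 : ℝ), g x = ∫⁻ x in Ioi (0 : ℝ), g x := by
    have h := (Measure.measurePreserving_neg (volume : Measure ℝ)).setLIntegral_comp_preimage_emb
      (MeasurableEquiv.neg ℝ).measurableEmbedding g (Iic 0)
    simp only [hg, neg_preimage, neg_Iic, neg_zero] at h
    rw [← h]
    exact setLIntegral_congr Ioi_ae_eq_Ici.symm
  rw [← lintegral_add_compl _ (measurableSet_Ioi (a := (0 : ℝ))), compl_Ioi, hIic, two_mul]

lemma map_abs_withDensity_of_even {g : ℝ → ENNReal} (hgm : Measurable g)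
    (hg : ∀ x, g (-x) = g x) :
    (volume.withDensity g).map (fun x => |x|) =
      (volume.restrict (Ioi (0 : ℝ))).withDensity fun x => 2 * g x := by
  refine Measure.ext_of_lintegral _ fun φ hφ => ?_
  have habs : Measurable fun x : ℝ => |x| := measurable_norm
  have hφabs : Measurable fun x : ℝ => φ |x| := hφ.comp habs
  rw [lintegral_map hφ habs, lintegral_withDensity_eq_lintegral_mul _ hgm hφabs,
    lintegral_withDensity_eq_lintegral_mul _ (hgm.const_mul 2) hφ,
    lintegral_eq_two_mul_setLIntegral_Ioi_of_even fun x => by simp [hg],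
    ← lintegral_const_mul _ (hgm.mul hφabs)]
  refine setLIntegral_congr_fun measurableSet_Ioi fun x (hx : 0 < x) => ?_
  simp only [Pi.mul_apply, abs_of_pos hx, mul_assoc]

lemma map_abs_cauchyMeasure :
    (cauchyMeasure 0 1).map (fun x => |x|) =
      (volume.restrict (Ioi (0 : ℝ))).withDensity fun x =>
        ENNReal.ofReal (2 / (Real.pi * (x ^ 2 + 1))) := by
  have heven (x : ℝ) : cauchyPDF 0 1 (-x) = cauchyPDF 0 1 x := by
    simp [cauchyPDF, cauchyPDFReal]
  rw [cauchyMeasure, if_neg one_ne_zero,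
    map_abs_withDensity_of_even (by fun_prop) heven]
  congr 1
  ext x
  rw [cauchyPDF, ← ENNReal.ofReal_ofNat, ← ENNReal.ofReal_mul zero_le_two]
  simp [cauchyPDFReal, div_eq_mul_inv, mul_comm]

end Density

section GammaData

lemma Gamma_one_sub_mul_Gamma_one_add {u : ℂ} (hu : u ≠ 0) :
    Complex.Gamma (1 - u) * Complex.Gamma (1 + u) = u * (Real.pi / Complex.sin (Real.pi * u)) := by
  rw [add_comm 1 u, Complex.Gamma_add_one u hu, ← Complex.Gamma_mul_Gamma_one_sub]
  ring

lemma Gamma_quotient_eq_sin {u v : ℂ} (hu : u ≠ 0) (hv : v ≠ 0) :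
    Complex.Gamma (1 - u) * Complex.Gamma (1 + u) /
        (Complex.Gamma (1 - v) * Complex.Gamma (1 + v)) =
      u * Complex.sin (Real.pi * v) / (v * Complex.sin (Real.pi * u)) := by
  have hpi : (Real.pi : ℂ) ≠ 0 := by exact_mod_cast Real.pi_ne_zero
  rw [Gamma_one_sub_mul_Gamma_one_add hu, Gamma_one_sub_mul_Gamma_one_add hv]
  simp only [div_eq_mul_inv, mul_inv, inv_inv]
  field_simp

/-- The data of `C Γ(1 - p s) Γ(1 + c + p s) / (Γ(1 - q s) Γ(1 + d + q s))`, the shape taken by the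
moments of a quotient of two independent, possibly tilted, stable variables. -/
noncomputable def reflectedGammaData (C p q c d : ℝ) (hp : 0 < p) (hq : 0 < q) : GammaData where
  J := 2
  K := 2
  C := C
  D := 1
  a := ![-p, p]
  b := ![1, 1 + c]
  a' := ![-q, q]
  b' := ![1, 1 + d]
  D_pos := one_pos
  a_ne j := by fin_cases j <;> simp [hp.ne']
  a'_ne j := by fin_cases j <;> simp [hq.ne']

/-- The data of `C Γ(1 + c - p s) / Γ(1 + d - q s)`, the shape taken by the moments of a tilted
stable variable. -/
noncomputable def tiltedGammaData (C p q c d : ℝ) (hp : 0 < p) (hq : 0 < q) : GammaData where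
  J := 1
  K := 1
  C := C
  D := 1
  a := ![-p]
  b := ![1 + c]
  a' := ![-q]
  b' := ![1 + d]
  D_pos := one_pos
  a_ne j := by fin_cases j; simp [hp.ne']
  a'_ne j := by fin_cases j; simp [hq.ne']

variable (C c d : ℝ) {p q : ℝ} (hp : 0 < p) (hq : 0 < q)

lemma reflectedGammaData_fn (s : ℂ) :
    (reflectedGammaData C p q c d hp hq).fn s =
      C * (Complex.Gamma (1 - p * s) * Complex.Gamma (1 + p * s + c) /
        (Complex.Gamma (1 - q * s) * Complex.Gamma (1 + q * s + d))) := by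
  rw [GammaData.fn, reflectedGammaData, Fin.prod_univ_two, Fin.prod_univ_two]
  simp only [Matrix.cons_val_zero, Matrix.cons_val_one, Complex.ofReal_one, Complex.one_cpow,
    mul_one, mul_div_assoc, Complex.ofReal_neg, Complex.ofReal_add]
  ring_nf

lemma reflectedGammaData_gam : (reflectedGammaData C p q c d hp hq).gam = 2 * p - 2 * q := by
  rw [GammaData.gam, reflectedGammaData, Fin.sum_univ_two, Fin.sum_univ_two]
  simp [abs_of_pos hp, abs_of_pos hq, two_mul]

lemma reflectedGammaData_gam' : (reflectedGammaData C p q c d hp hq).gam' = 0 := by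
  rw [GammaData.gam', reflectedGammaData, Fin.sum_univ_two, Fin.sum_univ_two]
  simp

lemma reflectedGammaData_del : (reflectedGammaData C p q c d hp hq).del = c - d := by
  rw [GammaData.del, reflectedGammaData, Fin.sum_univ_two, Fin.sum_univ_two]
  simp

lemma reflectedGammaData_kap : (reflectedGammaData C p q c d hp hq).kap = 0 := by
  rw [GammaData.kap, reflectedGammaData, Fin.sum_univ_two, Fin.sum_univ_two]
  simp

lemma reflectedGammaData_C₁ : (reflectedGammaData C p q 0 0 hp hq).C₁ = C * (p / q) := by
  have hhalf {x : ℝ} (hx : 0 < x) : x ^ (1 - 1 / 2 : ℝ) * x ^ (1 - 1 / 2 : ℝ) = x := by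
    rw [← Real.rpow_add hx]; norm_num
  rw [GammaData.C₁, reflectedGammaData, Fin.prod_univ_two, Fin.prod_univ_two]
  simp only [Matrix.cons_val_zero, Matrix.cons_val_one, abs_neg, abs_of_pos hp, abs_of_pos hq,
    add_zero, hhalf hp, hhalf hq, sub_self, zero_div, Real.rpow_zero, mul_one, mul_div_assoc]

lemma tiltedGammaData_fn (s : ℂ) :
    (tiltedGammaData C p q c d hp hq).fn s =
      C * (Complex.Gamma (1 - p * s + c) / Complex.Gamma (1 - q * s + d)) := by
  rw [GammaData.fn, tiltedGammaData, Fin.prod_univ_one, Fin.prod_univ_one]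
  simp only [Matrix.cons_val_fin_one, Complex.ofReal_one, Complex.one_cpow, mul_one,
    mul_div_assoc, Complex.ofReal_neg, Complex.ofReal_add]
  ring_nf

end GammaData

namespace IsPositiveStable

variable {Ω : Type*} [MeasurableSpace Ω] {μ : Measure Ω} [IsProbabilityMeasure μ] {S S' : Ω → ℝ}
  {α p a : ℝ}

lemma integrable_div_rpow_rpow_iff (h : IsPositiveStable α S μ) (h' : IsPositiveStable α S' μ)
    (hind : IndepFun S S' μ) (hα : 0 < α) (hα1 : α < 1) (p s : ℝ) :
    Integrable (fun ω => ((S ω / S' ω) ^ p) ^ s) μ ↔ p * s ∈ Set.Ioo (-α) α := by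
  rw [integrable_rpow_rpow_iff (ae_pos_div h.pos h'.pos),
    integrable_div_rpow_iff h.aemeasurable h'.aemeasurable h.pos h'.pos hind,
    h.integrable_rpow_iff hα hα1, h'.integrable_rpow_iff hα hα1, Set.mem_Ioo, neg_lt, and_comm]

lemma integrable_div_rpow_rpow_iff_mem_Ioo (h : IsPositiveStable α S μ)
    (h' : IsPositiveStable α S' μ) (hind : IndepFun S S' μ) (hα : 0 < α) (hα1 : α < 1)
    (hp : 0 < p) (hpa : p * a = α) (s : ℝ) :
    Integrable (fun ω => ((S ω / S' ω) ^ p) ^ s) μ ↔ s ∈ Set.Ioo (-a) a := by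
  rw [h.integrable_div_rpow_rpow_iff h' hind hα hα1, ← hpa, ← mul_neg, Set.mem_Ioo,
    mul_lt_mul_iff_right₀ hp, mul_lt_mul_iff_right₀ hp, Set.mem_Ioo]

lemma rhoPlus_div_rpow (h : IsPositiveStable α S μ) (h' : IsPositiveStable α S' μ)
    (hind : IndepFun S S' μ) (hα : 0 < α) (hα1 : α < 1) (hp : 0 < p) (hpa : p * a = α) :
    rhoPlus μ (fun ω => (S ω / S' ω) ^ p) = (a : EReal) :=
  rhoPlus_eq_of_integrable_iff (neg_lt_self (pos_of_mul_pos_right (hpa ▸ hα) hp.le))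
    (h.integrable_div_rpow_rpow_iff_mem_Ioo h' hind hα hα1 hp hpa)

lemma rhoMinus_div_rpow (h : IsPositiveStable α S μ) (h' : IsPositiveStable α S' μ)
    (hind : IndepFun S S' μ) (hα : 0 < α) (hα1 : α < 1) (hp : 0 < p) (hpa : p * a = α) :
    rhoMinus μ (fun ω => (S ω / S' ω) ^ p) = ((-a : ℝ) : EReal) :=
  rhoMinus_eq_of_integrable_iff (neg_lt_self (pos_of_mul_pos_right (hpa ▸ hα) hp.le))
    (h.integrable_div_rpow_rpow_iff_mem_Ioo h' hind hα hα1 hp hpa)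

lemma hasMoment_div (h : IsPositiveStable α S μ) (h' : IsPositiveStable α S' μ)
    (hind : IndepFun S S' μ) (hα : 0 < α) {s : ℂ} (hs : s.re ∈ Set.Ioo (-α) α) :
    HasMoment μ (fun ω => S ω / S' ω) s
      (Complex.Gamma (1 - s / α) * Complex.Gamma (1 + s / α) /
        (Complex.Gamma (1 - s) * Complex.Gamma (1 + s))) := by
  have hS := h.hasMoment hα hs.2
  have hS' := h'.hasMoment (s := -s) hα (by simpa using neg_lt.1 hs.1)
  refine ⟨(integrable_div_cpow_iff h.aemeasurable h'.aemeasurable h.pos h'.pos hind s).2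
    ⟨hS.1, hS'.1⟩, ?_⟩
  rw [cmoment_div h.aemeasurable h'.aemeasurable h.pos h'.pos hind, hS.2, hS'.2,
    div_mul_div_comm, neg_div, sub_neg_eq_add, sub_neg_eq_add]

lemma cmoment_div_eq_mul (h : IsPositiveStable α S μ) (h' : IsPositiveStable α S' μ)
    (hind : IndepFun S S' μ) (hα : 0 < α) {s : ℂ} (hs : -α < s.re) :
    cmoment μ (fun ω => S ω / S' ω) s = cmoment μ S s * cmoment μ S (-s) := by
  have hs' : (-s).re < α := by simpa using neg_lt.1 hs
  rw [cmoment_div h.aemeasurable h'.aemeasurable h.pos h'.pos hind, (h.hasMoment hα hs').2,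
    (h'.hasMoment hα hs').2]

lemma cmoment_div_eq_Gamma (h : IsPositiveStable α S μ) (h' : IsPositiveStable α S' μ)
    (hind : IndepFun S S' μ) (hα : 0 < α) {s : ℂ} (hs : s.re ∈ Set.Ioo (-α) α) (hs0 : s ≠ 0) :
    cmoment μ (fun ω => S ω / S' ω) s =
      Complex.Gamma (s / α) * Complex.Gamma (1 - s / α) /
        (α * Complex.Gamma s * Complex.Gamma (1 - s)) := by
  have hα0 : (α : ℂ) ≠ 0 := Complex.ofReal_ne_zero.2 hα.ne'
  rw [(h.hasMoment_div h' hind hα hs).2, add_comm 1 (s / α), add_comm 1 s,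
    Complex.Gamma_add_one _ hs0, Complex.Gamma_add_one _ (div_ne_zero hs0 hα0)]
  simp only [div_eq_mul_inv, mul_inv]
  field_simp

lemma hasMoment_div_rpow (h : IsPositiveStable α S μ) (h' : IsPositiveStable α S' μ)
    (hind : IndepFun S S' μ) (hα : 0 < α) (hp : 0 < p) (hpa : p * a = α) {s : ℂ}
    (hs : s.re ∈ Set.Ioo (-a) a) :
    HasMoment μ (fun ω => (S ω / S' ω) ^ p) s
      (Complex.Gamma (1 - s / a) * Complex.Gamma (1 + s / a) /
        (Complex.Gamma (1 - p * s) * Complex.Gamma (1 + p * s))) := by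
  have hps : (p * s).re ∈ Set.Ioo (-α) α := by
    rw [Complex.re_ofReal_mul, ← hpa, ← mul_neg]
    exact ⟨mul_lt_mul_of_pos_left hs.1 hp, mul_lt_mul_of_pos_left hs.2 hp⟩
  have hdiv : (p : ℂ) * s / α = s / a := by
    rw [← hpa, Complex.ofReal_mul, mul_div_mul_left _ _ (Complex.ofReal_ne_zero.2 hp.ne')]
  simpa only [hdiv] using
    HasMoment.rpow (ae_pos_div h.pos h'.pos) (h.hasMoment_div h' hind hα hps)

lemma cmoment_div_rpow_eq_sin (h : IsPositiveStable α S μ) (h' : IsPositiveStable α S' μ)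
    (hind : IndepFun S S' μ) (hα : 0 < α) (hp : 0 < p) (hpa : p * a = α) {s : ℂ}
    (hs : s.re ∈ Set.Ioo (-a) a) (hs0 : s ≠ 0) :
    cmoment μ (fun ω => (S ω / S' ω) ^ p) s =
      Complex.sin (Real.pi * (p * s)) / (α * Complex.sin (Real.pi * (s / a))) := by
  have hp0 : (p : ℂ) ≠ 0 := Complex.ofReal_ne_zero.2 hp.ne'
  have ha0 : (a : ℂ) ≠ 0 :=
    Complex.ofReal_ne_zero.2 (pos_of_mul_pos_right (hpa ▸ hα) hp.le).ne'
  rw [(h.hasMoment_div_rpow h' hind hα hp hpa hs).2,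
    Gamma_quotient_eq_sin (div_ne_zero hs0 ha0) (mul_ne_zero hp0 hs0), ← hpa, Complex.ofReal_mul]
  simp only [div_eq_mul_inv, mul_inv]
  field_simp

lemma exists_gammaData_div_rpow (h : IsPositiveStable α S μ) (h' : IsPositiveStable α S' μ)
    (hind : IndepFun S S' μ) (hα : 0 < α) (hp : 0 < p) (hpa : p * a = α) :
    ∃ g : GammaData,
      IsGammaType μ (fun ω => (S ω / S' ω) ^ p) {s | -a < s.re ∧ s.re < a} g ∧
      g.gam = 2 * a⁻¹ - 2 * p ∧ g.gam' = 0 ∧ g.del = 0 ∧ g.kap = 0 ∧ g.C₁ = 1 / α := by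
  have ha : 0 < a := pos_of_mul_pos_right (hpa ▸ hα) hp.le
  refine ⟨reflectedGammaData 1 a⁻¹ p 0 0 (inv_pos.2 ha) hp,
    ⟨ae_pos_rpow (ae_pos_div h.pos h'.pos) p, fun s hs => ?_⟩, reflectedGammaData_gam ..,
    reflectedGammaData_gam' .., ?_, reflectedGammaData_kap .., ?_⟩
  · rw [reflectedGammaData_fn]
    simpa [div_eq_inv_mul] using h.hasMoment_div_rpow h' hind hα hp hpa hs
  · rw [reflectedGammaData_del, sub_self]
  · rw [reflectedGammaData_C₁, one_mul, ← hpa, inv_eq_one_div, div_div, mul_comm a]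

end IsPositiveStable

lemma sin_pi_mul_div_two_ne_zero {s : ℂ} (hs : s.re ∈ Set.Ioo (-1) 1) (hs0 : s ≠ 0) :
    Complex.sin (Real.pi * s / 2) ≠ 0 := by
  rw [Complex.sin_ne_zero_iff]
  intro k hk
  have hsk : s = ((2 * k : ℝ) : ℂ) := by
    apply mul_left_cancel₀ (Complex.ofReal_ne_zero.2 Real.pi_ne_zero)
    push_cast
    linear_combination 2 * hk
  rw [hsk, Complex.ofReal_re] at hs
  have hlower : -1 < 2 * k := by exact_mod_cast hs.1
  have hupper : 2 * k < 1 := by exact_mod_cast hs.2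
  obtain rfl : k = 0 := by omega
  exact hs0 (by simpa using hsk)

namespace IsPositiveStable

variable {Ω : Type*} [MeasurableSpace Ω] {μ : Measure Ω} {S S' : Ω → ℝ} {α β : ℝ}

lemma ae_div_rpow_self_eq (h : IsPositiveStable α S μ) (h' : IsPositiveStable α S' μ) :
    ∀ᵐ ω ∂μ, (S ω / S' ω) ^ α = S' ω ^ (-α) / S ω ^ (-α) := by
  filter_upwards [h.pos, h'.pos] with ω hS hS'
  rw [Real.div_rpow hS.le hS'.le, Real.rpow_neg hS.le, Real.rpow_neg hS'.le, inv_div_inv]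

lemma ae_div_rpow_div_rpow_one_div (h : IsPositiveStable (α / β) S μ)
    (h' : IsPositiveStable (α / β) S' μ) (hα : α ≠ 0) :
    ∀ᵐ ω ∂μ, ((S ω / S' ω) ^ (α / β)) ^ (1 / α) = (S ω / S' ω) ^ (1 / β) := by
  filter_upwards [ae_pos_div h.pos h'.pos] with ω hω
  rw [← Real.rpow_mul hω.le, div_mul_div_comm, mul_one, mul_comm β, div_mul_cancel_left₀ hα,
    one_div]

lemma cmoment_div_rpow_one_div (h : IsPositiveStable (α / β) S μ)
    (h' : IsPositiveStable (α / β) S' μ) (s : ℂ) :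
    cmoment μ (fun ω => (S ω / S' ω) ^ (1 / β)) s = cmoment μ (fun ω => S ω / S' ω) (s / β) := by
  rw [cmoment_rpow (ae_pos_div h.pos h'.pos)]
  push_cast
  rw [one_div_mul_eq_div]

variable [IsProbabilityMeasure μ]

lemma cmoment_div_eq_sin (h : IsPositiveStable α S μ) (h' : IsPositiveStable α S' μ)
    (hind : IndepFun S S' μ) (hα : 0 < α) {s : ℂ} (hs : s.re ∈ Set.Ioo (-α) α) (hs0 : s ≠ 0) :
    cmoment μ (fun ω => S ω / S' ω) s =
      Complex.sin (Real.pi * s) / (α * Complex.sin (Real.pi * s / α)) := by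
  simpa [mul_div_assoc] using
    h.cmoment_div_rpow_eq_sin h' hind hα one_pos (one_mul α) hs hs0

lemma exists_gammaData_div (h : IsPositiveStable α S μ) (h' : IsPositiveStable α S' μ)
    (hind : IndepFun S S' μ) (hα : 0 < α) :
    ∃ g : GammaData,
      IsGammaType μ (fun ω => S ω / S' ω) {s | -α < s.re ∧ s.re < α} g ∧
      g.gam = 2 * α⁻¹ - 2 ∧ g.gam' = 0 ∧ g.del = 0 ∧ g.kap = 0 ∧ g.C₁ = 1 / α := by
  simpa using h.exists_gammaData_div_rpow h' hind hα one_pos (one_mul α)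

lemma rhoPlus_div (h : IsPositiveStable α S μ) (h' : IsPositiveStable α S' μ)
    (hind : IndepFun S S' μ) (hα : 0 < α) (hα1 : α < 1) :
    rhoPlus μ (fun ω => S ω / S' ω) = (α : EReal) := by
  simpa only [Real.rpow_one] using h.rhoPlus_div_rpow h' hind hα hα1 one_pos (one_mul α)

lemma rhoMinus_div (h : IsPositiveStable α S μ) (h' : IsPositiveStable α S' μ)
    (hind : IndepFun S S' μ) (hα : 0 < α) (hα1 : α < 1) :
    rhoMinus μ (fun ω => S ω / S' ω) = ((-α : ℝ) : EReal) := by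
  simpa only [Real.rpow_one] using h.rhoMinus_div_rpow h' hind hα hα1 one_pos (one_mul α)

lemma hasMoment_div_rpow_self (h : IsPositiveStable α S μ) (h' : IsPositiveStable α S' μ)
    (hind : IndepFun S S' μ) (hα : 0 < α) {s : ℂ} (hs : s.re ∈ Set.Ioo (-1) 1) :
    HasMoment μ (fun ω => (S ω / S' ω) ^ α) s
      (Complex.Gamma (1 - s) * Complex.Gamma (1 + s) /
        (Complex.Gamma (1 - α * s) * Complex.Gamma (1 + α * s))) := by
  simpa using h.hasMoment_div_rpow h' hind hα hα (mul_one α) hs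

lemma cmoment_div_rpow_self_eq_sin (h : IsPositiveStable α S μ) (h' : IsPositiveStable α S' μ)
    (hind : IndepFun S S' μ) (hα : 0 < α) {s : ℂ} (hs : s.re ∈ Set.Ioo (-1) 1) (hs0 : s ≠ 0) :
    cmoment μ (fun ω => (S ω / S' ω) ^ α) s =
      Complex.sin (Real.pi * α * s) / (α * Complex.sin (Real.pi * s)) := by
  simpa [mul_assoc] using h.cmoment_div_rpow_eq_sin h' hind hα hα (mul_one α) hs hs0

lemma exists_gammaData_div_rpow_self (h : IsPositiveStable α S μ) (h' : IsPositiveStable α S' μ)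
    (hind : IndepFun S S' μ) (hα : 0 < α) :
    ∃ g : GammaData,
      IsGammaType μ (fun ω => (S ω / S' ω) ^ α) {s | -1 < s.re ∧ s.re < 1} g ∧
      g.gam = 2 - 2 * α ∧ g.gam' = 0 ∧ g.del = 0 ∧ g.kap = 0 ∧ g.C₁ = 1 / α := by
  simpa using h.exists_gammaData_div_rpow h' hind hα hα (mul_one α)

lemma integral_div_rpow_self_rpow (h : IsPositiveStable α S μ) (h' : IsPositiveStable α S' μ)
    (hind : IndepFun S S' μ) (hα : 0 < α) {s : ℝ} (hs : s ∈ Set.Ioo (-1) 1) (hs0 : s ≠ 0) :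
    ∫ ω, ((S ω / S' ω) ^ α) ^ s ∂μ =
      Real.sin (Real.pi * α * s) / (α * Real.sin (Real.pi * s)) := by
  have hmoment := h.cmoment_div_rpow_self_eq_sin h' hind hα (s := s) hs
    (Complex.ofReal_ne_zero.2 hs0)
  rw [cmoment_ofReal (ae_pos_rpow (ae_pos_div h.pos h'.pos) α)] at hmoment
  exact_mod_cast hmoment

lemma hasPosDensity_div_rpow_self (h : IsPositiveStable α S μ) (h' : IsPositiveStable α S' μ)
    (hind : IndepFun S S' μ) (hα : 0 < α) (hα1 : α < 1) :
    HasPosDensity μ (fun ω => (S ω / S' ω) ^ α) fun x =>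
      Real.sin (Real.pi * α) / (Real.pi * α) * lampertiKernel (Real.pi * α) x := by
  have hθ : Real.pi * α ∈ Set.Ioo 0 Real.pi :=
    ⟨mul_pos Real.pi_pos hα, mul_lt_of_lt_one_right Real.pi_pos hα1⟩
  have hsin := Real.sin_pos_of_mem_Ioo hθ
  refine hasPosDensity_of_integral_rpow_eq
    ((h.aemeasurable.fun_div h'.aemeasurable).pow_const α)
    (ae_pos_rpow (ae_pos_div h.pos h'.pos) α) (by unfold lampertiKernel; fun_prop)
    (fun x _ => (mul_pos (div_pos hsin hθ.1) (lampertiKernel_pos hθ x)).le)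
    (isOpen_Ioo (a := -1) (b := 1)) Set.ordConnected_Ioo (by norm_num)
    (fun s => (h.integrable_div_rpow_rpow_iff_mem_Ioo h' hind hα hα1 hα (mul_one α) s).2)
    (fun s hs => ?_) (c := -1) (d := 0) (by norm_num)
    (Set.Ioo_subset_Ioo_right zero_le_one) fun s hs hs0 => ?_
  · simp only [mul_left_comm _ (Real.sin _ / _)]
    exact (integrableOn_rpow_mul_lampertiKernel hθ hs.1 hs.2).const_mul _
  · simp only [mul_left_comm _ (Real.sin _ / _)]
    rw [h.integral_div_rpow_self_rpow h' hind hα ⟨hs, hs0.trans one_pos⟩ hs0.ne,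
      integral_const_mul, integral_rpow_mul_lampertiKernel hθ hs hs0]
    field_simp

lemma hasPosDensity_div (h : IsPositiveStable α S μ) (h' : IsPositiveStable α S' μ)
    (hind : IndepFun S S' μ) (hα : 0 < α) (hα1 : α < 1) :
    HasPosDensity μ (fun ω => S ω / S' ω) fun x =>
      Real.sin (Real.pi * α) / Real.pi *
        (x ^ (α - 1) / (x ^ (2 * α) + 2 * Real.cos (Real.pi * α) * x ^ α + 1)) := by
  have hlaw := HasPosDensity.of_rpow hα (h.aemeasurable.fun_div h'.aemeasurable)
    (ae_pos_div h.pos h'.pos) (by unfold lampertiKernel; fun_prop)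
    (h.hasPosDensity_div_rpow_self h' hind hα hα1)
  refine ⟨hlaw.aemeasurable, hlaw.map_eq.trans <| withDensity_congr_ae ?_⟩
  filter_upwards [ae_restrict_mem measurableSet_Ioi] with x (hx : 0 < x)
  rw [mul_comm 2 α, Real.rpow_mul hx.le, Real.rpow_two, lampertiKernel]
  field_simp

lemma cmoment_div_rpow_half (h : IsPositiveStable (1 / 2) S μ) (h' : IsPositiveStable (1 / 2) S' μ)
    (hind : IndepFun S S' μ) {s : ℂ} (hs : s.re ∈ Set.Ioo (-1) 1) :
    cmoment μ (fun ω => (S ω / S' ω) ^ (1 / 2 : ℝ)) s = 1 / Complex.cos (Real.pi * s / 2) := by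
  rcases eq_or_ne s 0 with rfl | hs0
  · rw [(h.hasMoment_div_rpow_self h' hind one_half_pos hs).2]
    simp
  have hsin := sin_pi_mul_div_two_ne_zero hs hs0
  have hdouble : Complex.sin (Real.pi * s) =
      2 * Complex.sin (Real.pi * s / 2) * Complex.cos (Real.pi * s / 2) := by
    rw [← Complex.sin_two_mul, mul_div_cancel₀ _ two_ne_zero]
  rw [h.cmoment_div_rpow_self_eq_sin h' hind one_half_pos hs hs0, hdouble,
    show (Real.pi : ℂ) * (1 / 2 : ℝ) * s = Real.pi * s / 2 by push_cast; ring]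
  push_cast
  field_simp

lemma hasLaw_div_rpow_half (h : IsPositiveStable (1 / 2) S μ) (h' : IsPositiveStable (1 / 2) S' μ)
    (hind : IndepFun S S' μ) :
    HasLaw (fun ω => (S ω / S' ω) ^ (1 / 2 : ℝ)) ((cauchyMeasure 0 1).map fun x => |x|) μ := by
  have hlaw := h.hasPosDensity_div_rpow_self h' hind one_half_pos one_half_lt_one
  refine ⟨hlaw.aemeasurable, hlaw.map_eq.trans ?_⟩
  rw [map_abs_cauchyMeasure]
  congr 1 with x
  simp only [lampertiKernel, mul_one_div Real.pi, Real.sin_pi_div_two, Real.cos_pi_div_two,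
    mul_zero, zero_mul, add_zero]
  congr 1
  field_simp

lemma hasMoment_div_rpow_one_div (h : IsPositiveStable (α / β) S μ)
    (h' : IsPositiveStable (α / β) S' μ) (hind : IndepFun S S' μ) (hα : 0 < α) (hβ : 0 < β) {s : ℂ}
    (hs : s.re ∈ Set.Ioo (-α) α) :
    HasMoment μ (fun ω => (S ω / S' ω) ^ (1 / β)) s
      (Complex.Gamma (1 + s / α) * Complex.Gamma (1 - s / α) /
        (Complex.Gamma (1 + s / β) * Complex.Gamma (1 - s / β))) := by
  simpa [mul_comm, div_eq_mul_inv] using h.hasMoment_div_rpow h' hind (div_pos hα hβ)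
    (one_div_pos.2 hβ) (one_div_mul_eq_div β α) hs

lemma cmoment_div_rpow_one_div_eq_sin (h : IsPositiveStable (α / β) S μ)
    (h' : IsPositiveStable (α / β) S' μ) (hind : IndepFun S S' μ) (hα : 0 < α) (hβ : 0 < β) {s : ℂ}
    (hs : s.re ∈ Set.Ioo (-α) α) (hs0 : s ≠ 0) :
    cmoment μ (fun ω => (S ω / S' ω) ^ (1 / β)) s =
      β * Complex.sin (Real.pi * s / β) / (α * Complex.sin (Real.pi * s / α)) := by
  rw [h.cmoment_div_rpow_eq_sin h' hind (div_pos hα hβ) (one_div_pos.2 hβ)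
    (one_div_mul_eq_div β α) hs hs0, Complex.ofReal_div, Complex.ofReal_div, Complex.ofReal_one,
    one_div_mul_eq_div, ← mul_div_assoc, ← mul_div_assoc]
  simp only [div_eq_mul_inv, mul_inv, inv_inv]
  ring_nf

lemma exists_gammaData_div_rpow_one_div (h : IsPositiveStable (α / β) S μ)
    (h' : IsPositiveStable (α / β) S' μ) (hind : IndepFun S S' μ) (hα : 0 < α) (hβ : 0 < β) :
    ∃ g : GammaData,
      IsGammaType μ (fun ω => (S ω / S' ω) ^ (1 / β)) {s | -α < s.re ∧ s.re < α} g ∧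
      g.gam = 2 * α⁻¹ - 2 * β⁻¹ ∧ g.gam' = 0 ∧ g.del = 0 ∧ g.kap = 0 ∧ g.C₁ = β / α := by
  simpa using h.exists_gammaData_div_rpow h' hind (div_pos hα hβ) (one_div_pos.2 hβ)
    (one_div_mul_eq_div β α)

end IsPositiveStable

section Tilt

variable {Ω : Type*} [MeasurableSpace Ω] {μ : Measure Ω} {S T : Ω → ℝ} {r : ℝ}

lemma ae_pos_of_hasLaw_powTilt (hSm : AEMeasurable S μ) (hS : ∀ᵐ ω ∂μ, 0 < S ω)
    (hT : HasLaw T (powTilt (μ.map S) r) μ) : ∀ᵐ ω ∂μ, 0 < T ω := by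
  have hpos : ∀ᵐ x ∂(μ.map S), 0 < x := (ae_map_iff hSm measurableSet_Ioi).2 hS
  rw [← ae_map_iff hT.aemeasurable measurableSet_Ioi, hT.map_eq]
  exact (withDensity_absolutelyContinuous _ _).ae_le hpos

lemma integral_rpow_pos [NeZero μ] (hS : ∀ᵐ ω ∂μ, 0 < S ω)
    (hr : Integrable (fun ω => S ω ^ r) μ) : 0 < ∫ ω, S ω ^ r ∂μ := by
  have hpos := ae_pos_rpow hS r
  have hsupport : Function.support (fun ω => S ω ^ r) =ᵐ[μ] Set.univ :=
    Filter.eventuallyEq_univ.2 (hpos.mono fun _ => ne_of_gt)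
  rw [integral_pos_iff_support_of_nonneg_ae (hpos.mono fun _ => le_of_lt) hr,
    measure_congr hsupport]
  exact Measure.measure_univ_pos.2 (NeZero.ne μ)

lemma ae_powTilt_density_smul_cpow (hS : ∀ᵐ ω ∂μ, 0 < S ω) {c : ℝ} (hc : 0 < c) (s : ℂ) :
    ∀ᵐ ω ∂μ, (ENNReal.ofReal (S ω ^ r / c)).toReal • (S ω : ℂ) ^ s =
      (S ω : ℂ) ^ (s + r) / c := by
  filter_upwards [hS] with ω hω
  rw [ENNReal.toReal_ofReal (by positivity), Complex.real_smul, Complex.ofReal_div,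
    Complex.ofReal_cpow hω.le, Complex.cpow_add _ _ (Complex.ofReal_ne_zero.2 hω.ne')]
  ring

variable [NeZero μ]

lemma integrable_cpow_iff_of_hasLaw_powTilt (hSm : AEMeasurable S μ) (hS : ∀ᵐ ω ∂μ, 0 < S ω)
    (hr : Integrable (fun ω => S ω ^ r) μ) (hT : HasLaw T (powTilt (μ.map S) r) μ) (s : ℂ) :
    Integrable (fun ω => (T ω : ℂ) ^ s) μ ↔ Integrable (fun ω => (S ω : ℂ) ^ (s + r)) μ := by
  have hc := integral_rpow_pos hS hr
  have hmap : ∫ x, x ^ r ∂(μ.map S) = ∫ ω, S ω ^ r ∂μ :=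
    integral_map hSm (Measurable.aestronglyMeasurable (by fun_prop))
  rw [← Function.comp_def (fun x : ℝ => (x : ℂ) ^ s) T,
    ← integrable_map_measure (Measurable.aestronglyMeasurable (by fun_prop)) hT.aemeasurable,
    hT.map_eq, powTilt, hmap,
    integrable_withDensity_iff_integrable_smul' (by fun_prop)
      (ae_of_all _ fun _ => ENNReal.ofReal_lt_top),
    integrable_map_measure (Measurable.aestronglyMeasurable (by fun_prop)) hSm, Function.comp_def,
    integrable_congr (ae_powTilt_density_smul_cpow hS hc s)]
  simp only [div_eq_mul_inv]
  exact integrable_mul_const_iff (IsUnit.mk0 _ (inv_ne_zero (Complex.ofReal_ne_zero.2 hc.ne'))) _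

lemma cmoment_of_hasLaw_powTilt (hSm : AEMeasurable S μ) (hS : ∀ᵐ ω ∂μ, 0 < S ω)
    (hr : Integrable (fun ω => S ω ^ r) μ) (hT : HasLaw T (powTilt (μ.map S) r) μ) (s : ℂ) :
    cmoment μ T s = cmoment μ S (s + r) / cmoment μ S r := by
  have hc := integral_rpow_pos hS hr
  have hmap : ∫ x, x ^ r ∂(μ.map S) = ∫ ω, S ω ^ r ∂μ :=
    integral_map hSm (Measurable.aestronglyMeasurable (by fun_prop))
  rw [cmoment_ofReal hS, cmoment, cmoment,
    ← integral_map (f := fun x : ℝ => (x : ℂ) ^ s) hT.aemeasurable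
      (Measurable.aestronglyMeasurable (by fun_prop)), hT.map_eq, powTilt, hmap,
    integral_withDensity_eq_integral_toReal_smul (by fun_prop)
      (ae_of_all _ fun _ => ENNReal.ofReal_lt_top),
    integral_map hSm (Measurable.aestronglyMeasurable (by fun_prop)),
    integral_congr_ae (ae_powTilt_density_smul_cpow hS hc s), integral_div]

end Tilt

namespace IsPositiveStable

variable {Ω : Type*} [MeasurableSpace Ω] {μ : Measure Ω} {S T : Ω → ℝ} {α θ : ℝ}

lemma cmoment_div_tilt (h : IsPositiveStable α S μ) (hT : HasLaw T (powTilt (μ.map S) (-θ)) μ)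
    (hind : IndepFun S T μ) (s : ℂ) :
    cmoment μ (fun ω => S ω / T ω) s = cmoment μ S s * cmoment μ T (-s) :=
  cmoment_div h.aemeasurable hT.aemeasurable h.pos
    (ae_pos_of_hasLaw_powTilt h.aemeasurable h.pos hT) hind s

variable [IsProbabilityMeasure μ]

lemma integrable_rpow_neg (h : IsPositiveStable α S μ) (hα : 0 < α) (hθ : -α < θ) :
    Integrable (fun ω => S ω ^ (-θ)) μ :=
  h.integrable_rpow hα (neg_lt.1 hθ)

lemma cmoment_tilt (h : IsPositiveStable α S μ) (hα : 0 < α) (hθ : -α < θ)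
    (hT : HasLaw T (powTilt (μ.map S) (-θ)) μ) (s : ℂ) :
    cmoment μ T s = cmoment μ S (s - θ) / cmoment μ S (-θ) := by
  simpa [sub_eq_add_neg] using cmoment_of_hasLaw_powTilt h.aemeasurable h.pos
    (h.integrable_rpow_neg hα hθ) hT s

lemma hasMoment_tilt (h : IsPositiveStable α S μ) (hα : 0 < α) (hθ : -α < θ)
    (hT : HasLaw T (powTilt (μ.map S) (-θ)) μ) {s : ℂ} (hs : s.re < α + θ) :
    HasMoment μ T s
      (Complex.Gamma (1 + θ) / Complex.Gamma (1 + θ / α) *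
        (Complex.Gamma (1 - s / α + θ / α) / Complex.Gamma (1 - s + θ))) := by
  have hnum := h.hasMoment (s := s - θ) hα (by simpa [sub_lt_iff_lt_add] using hs)
  have hden := h.hasMoment (s := -θ) hα (by simpa using neg_lt.1 hθ)
  refine ⟨(integrable_cpow_iff_of_hasLaw_powTilt h.aemeasurable h.pos
    (h.integrable_rpow_neg hα hθ) hT s).2 (by simpa [sub_eq_add_neg] using hnum.1), ?_⟩
  rw [h.cmoment_tilt hα hθ hT, hnum.2, hden.2, sub_div, ← sub_add, ← sub_add, neg_div,
    sub_neg_eq_add, sub_neg_eq_add, div_div_eq_mul_div, mul_comm, mul_div_right_comm]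

lemma integrable_rpow_tilt_iff (h : IsPositiveStable α S μ) (hα : 0 < α) (hα1 : α < 1)
    (hθ : -α < θ) (hT : HasLaw T (powTilt (μ.map S) (-θ)) μ) (s : ℝ) :
    Integrable (fun ω => T ω ^ s) μ ↔ s < α + θ := by
  have hTpos := ae_pos_of_hasLaw_powTilt h.aemeasurable h.pos hT
  have htilt := integrable_cpow_iff_of_hasLaw_powTilt h.aemeasurable h.pos
    (h.integrable_rpow_neg hα hθ) hT s
  rw [integrable_cpow_iff hT.aemeasurable hTpos, integrable_cpow_iff h.aemeasurable h.pos,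
    h.integrable_rpow_iff hα hα1] at htilt
  simpa [← sub_eq_add_neg, sub_lt_iff_lt_add] using htilt

lemma exists_gammaData_tilt (h : IsPositiveStable α S μ) (hα : 0 < α) (hθ : -α < θ)
    (hT : HasLaw T (powTilt (μ.map S) (-θ)) μ) :
    ∃ g : GammaData, IsGammaType μ T {s | s.re < α + θ} g := by
  refine ⟨tiltedGammaData (Real.Gamma (1 + θ) / Real.Gamma (1 + θ / α)) (1 / α) 1 (θ / α) θ
    (one_div_pos.2 hα) one_pos, ae_pos_of_hasLaw_powTilt h.aemeasurable h.pos hT, fun s hs => ?_⟩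
  simpa [tiltedGammaData_fn, ← Complex.Gamma_ofReal, div_eq_inv_mul] using
    h.hasMoment_tilt hα hθ hT hs

lemma hasMoment_div_tilt (h : IsPositiveStable α S μ) (hα : 0 < α) (hθ : -α < θ)
    (hT : HasLaw T (powTilt (μ.map S) (-θ)) μ) (hind : IndepFun S T μ) {s : ℂ}
    (hs : s.re ∈ Set.Ioo (-α - θ) α) :
    HasMoment μ (fun ω => S ω / T ω) s
      (Complex.Gamma (1 + θ) / Complex.Gamma (1 + θ / α) *
        (Complex.Gamma (1 - s / α) * Complex.Gamma (1 + s / α + θ / α) /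
          (Complex.Gamma (1 - s) * Complex.Gamma (1 + s + θ)))) := by
  have hTpos := ae_pos_of_hasLaw_powTilt h.aemeasurable h.pos hT
  have hS := h.hasMoment hα hs.2
  have hT' := h.hasMoment_tilt (s := -s) hα hθ hT (by rw [Complex.neg_re]; linarith [hs.1])
  refine ⟨(integrable_div_cpow_iff h.aemeasurable hT.aemeasurable h.pos hTpos hind s).2
    ⟨hS.1, hT'.1⟩, ?_⟩
  rw [h.cmoment_div_tilt hT hind, hS.2, hT'.2, neg_div, sub_neg_eq_add, sub_neg_eq_add,
    mul_left_comm, div_mul_div_comm]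

lemma exists_gammaData_div_tilt (h : IsPositiveStable α S μ) (hα : 0 < α) (hθ : -α < θ)
    (hT : HasLaw T (powTilt (μ.map S) (-θ)) μ) (hind : IndepFun S T μ) :
    ∃ g : GammaData,
      IsGammaType μ (fun ω => S ω / T ω) {s | -α - θ < s.re ∧ s.re < α} g ∧
      g.gam = 2 * (1 / α - 1) ∧ g.gam' = 0 ∧ g.del = θ * (1 / α - 1) ∧ g.kap = 0 := by
  refine ⟨reflectedGammaData (Real.Gamma (1 + θ) / Real.Gamma (1 + θ / α)) (1 / α) 1 (θ / α) θ
    (one_div_pos.2 hα) one_pos,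
    ⟨ae_pos_div h.pos (ae_pos_of_hasLaw_powTilt h.aemeasurable h.pos hT), fun s hs => ?_⟩, ?_,
    reflectedGammaData_gam' .., ?_, reflectedGammaData_kap ..⟩
  · simpa [reflectedGammaData_fn, ← Complex.Gamma_ofReal, div_eq_inv_mul] using
      h.hasMoment_div_tilt hα hθ hT hind hs
  · rw [reflectedGammaData_gam, mul_sub]
  · rw [reflectedGammaData_del]
    ring

lemma integrable_div_tilt_rpow_iff (h : IsPositiveStable α S μ) (hα : 0 < α) (hα1 : α < 1)
    (hθ : -α < θ) (hT : HasLaw T (powTilt (μ.map S) (-θ)) μ) (hind : IndepFun S T μ) (s : ℝ) :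
    Integrable (fun ω => (S ω / T ω) ^ s) μ ↔ s ∈ Set.Ioo (-α - θ) α := by
  rw [integrable_div_rpow_iff h.aemeasurable hT.aemeasurable h.pos
    (ae_pos_of_hasLaw_powTilt h.aemeasurable h.pos hT) hind, h.integrable_rpow_iff hα hα1,
    h.integrable_rpow_tilt_iff hα hα1 hθ hT, neg_lt, neg_add', Set.mem_Ioo, and_comm]

lemma rhoPlus_div_tilt (h : IsPositiveStable α S μ) (hα : 0 < α) (hα1 : α < 1) (hθ : -α < θ)
    (hT : HasLaw T (powTilt (μ.map S) (-θ)) μ) (hind : IndepFun S T μ) :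
    rhoPlus μ (fun ω => S ω / T ω) = (α : EReal) :=
  rhoPlus_eq_of_integrable_iff (by linarith)
    (h.integrable_div_tilt_rpow_iff hα hα1 hθ hT hind)

lemma rhoMinus_div_tilt (h : IsPositiveStable α S μ) (hα : 0 < α) (hα1 : α < 1) (hθ : -α < θ)
    (hT : HasLaw T (powTilt (μ.map S) (-θ)) μ) (hind : IndepFun S T μ) :
    rhoMinus μ (fun ω => S ω / T ω) = ((-α - θ : ℝ) : EReal) :=
  rhoMinus_eq_of_integrable_iff (by linarith)
    (h.integrable_div_tilt_rpow_iff hα hα1 hθ hT hind)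

end IsPositiveStable

end GammaMoments

theorem mainTheorem7_general {Ω : Type*} [MeasurableSpace Ω] (μ : Measure Ω)
    [IsProbabilityMeasure μ] :
    (∀ (α : ℝ) (S S' : Ω → ℝ), 0 < α → α < 1 →
      IsPositiveStable α S μ → IsPositiveStable α S' μ → IndepFun S S' μ →
      (∀ s : ℂ, -α < s.re → s.re < α →
        HasMoment μ (fun ω => S ω / S' ω) s
          (Complex.Gamma (1 - s / α) * Complex.Gamma (1 + s / α) /
            (Complex.Gamma (1 - s) * Complex.Gamma (1 + s))) ∧
        cmoment μ (fun ω => S ω / S' ω) s = cmoment μ S s * cmoment μ S (-s) ∧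
        (s ≠ 0 →
          cmoment μ (fun ω => S ω / S' ω) s =
            Complex.Gamma (s / α) * Complex.Gamma (1 - s / α) /
              (α * Complex.Gamma s * Complex.Gamma (1 - s)) ∧
          cmoment μ (fun ω => S ω / S' ω) s =
            Complex.sin (Real.pi * s) / (α * Complex.sin (Real.pi * s / α)))) ∧
      (∃ g : GammaData,
        IsGammaType μ (fun ω => S ω / S' ω) {s | -α < s.re ∧ s.re < α} g ∧
        g.gam = 2 * α⁻¹ - 2 ∧ g.gam' = 0 ∧ g.del = 0 ∧ g.kap = 0 ∧ g.C₁ = 1 / α) ∧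
      rhoPlus μ (fun ω => S ω / S' ω) = (α : ℝ) ∧
      rhoMinus μ (fun ω => S ω / S' ω) = ((-α : ℝ) : EReal) ∧
      IsMittagLeffler α (fun ω => S ω ^ (-α)) μ ∧
      IsMittagLeffler α (fun ω => S' ω ^ (-α)) μ ∧
      IndepFun (fun ω => S ω ^ (-α)) (fun ω => S' ω ^ (-α)) μ ∧
      (∀ᵐ ω ∂μ, (S ω / S' ω) ^ α = S' ω ^ (-α) / S ω ^ (-α)) ∧
      (∀ s : ℂ, -1 < s.re → s.re < 1 →
        HasMoment μ (fun ω => (S ω / S' ω) ^ α) s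
          (Complex.Gamma (1 - s) * Complex.Gamma (1 + s) /
            (Complex.Gamma (1 - α * s) * Complex.Gamma (1 + α * s))) ∧
        (s ≠ 0 →
          cmoment μ (fun ω => (S ω / S' ω) ^ α) s =
            Complex.sin (Real.pi * α * s) / (α * Complex.sin (Real.pi * s)))) ∧
      (∃ g : GammaData,
        IsGammaType μ (fun ω => (S ω / S' ω) ^ α) {s | -1 < s.re ∧ s.re < 1} g ∧
        g.gam = 2 - 2 * α ∧ g.gam' = 0 ∧ g.del = 0 ∧ g.kap = 0 ∧ g.C₁ = 1 / α) ∧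
      rhoPlus μ (fun ω => (S ω / S' ω) ^ α) = ((1 : ℝ) : EReal) ∧
      rhoMinus μ (fun ω => (S ω / S' ω) ^ α) = ((-1 : ℝ) : EReal) ∧
      HasPosDensity μ (fun ω => (S ω / S' ω) ^ α) (fun x =>
        Real.sin (Real.pi * α) / (Real.pi * α) *
          (1 / (x ^ 2 + 2 * Real.cos (Real.pi * α) * x + 1))) ∧
      HasPosDensity μ (fun ω => S ω / S' ω) (fun x =>
        Real.sin (Real.pi * α) / Real.pi *
          (x ^ (α - 1) / (x ^ (2 * α) + 2 * Real.cos (Real.pi * α) * x ^ α + 1))) ∧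
      (α = 1 / 2 →
        (∀ s : ℂ, -1 < s.re → s.re < 1 →
          cmoment μ (fun ω => (S ω / S' ω) ^ α) s = 1 / Complex.cos (Real.pi * s / 2)) ∧
        HasLaw (fun ω => (S ω / S' ω) ^ α) ((cauchyMeasure 0 1).map fun x => |x|) μ)) ∧
    (∀ (α β : ℝ) (S S' : Ω → ℝ), 0 < α → α < β →
      IsPositiveStable (α / β) S μ → IsPositiveStable (α / β) S' μ → IndepFun S S' μ →
      (∀ᵐ ω ∂μ, ((S ω / S' ω) ^ (α / β)) ^ (1 / α) = (S ω / S' ω) ^ (1 / β)) ∧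
      (∀ s : ℂ, -α < s.re → s.re < α →
        HasMoment μ (fun ω => (S ω / S' ω) ^ (1 / β)) s
          (Complex.Gamma (1 + s / α) * Complex.Gamma (1 - s / α) /
            (Complex.Gamma (1 + s / β) * Complex.Gamma (1 - s / β))) ∧
        cmoment μ (fun ω => (S ω / S' ω) ^ (1 / β)) s =
          cmoment μ (fun ω => S ω / S' ω) (s / β) ∧
        (s ≠ 0 →
          cmoment μ (fun ω => (S ω / S' ω) ^ (1 / β)) s =
            β * Complex.sin (Real.pi * s / β) / (α * Complex.sin (Real.pi * s / α)))) ∧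
      (∃ g : GammaData,
        IsGammaType μ (fun ω => (S ω / S' ω) ^ (1 / β)) {s | -α < s.re ∧ s.re < α} g ∧
        g.gam = 2 * α⁻¹ - 2 * β⁻¹ ∧ g.gam' = 0 ∧ g.del = 0 ∧ g.kap = 0 ∧ g.C₁ = β / α) ∧
      rhoPlus μ (fun ω => (S ω / S' ω) ^ (1 / β)) = (α : ℝ) ∧
      rhoMinus μ (fun ω => (S ω / S' ω) ^ (1 / β)) = ((-α : ℝ) : EReal)) ∧
    (∀ (α θ : ℝ) (S T : Ω → ℝ), 0 < α → α < 1 → -α < θ →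
      IsPositiveStable α S μ → HasLaw T (powTilt (μ.map S) (-θ)) μ → IndepFun S T μ →
      Integrable (fun ω => S ω ^ (-θ)) μ ∧ 0 < ∫ ω, S ω ^ (-θ) ∂μ ∧
      (∀ s : ℂ, s.re < α + θ →
        HasMoment μ T s
          (Complex.Gamma (1 + θ) / Complex.Gamma (1 + θ / α) *
            (Complex.Gamma (1 - s / α + θ / α) / Complex.Gamma (1 - s + θ))) ∧
        cmoment μ T s = cmoment μ S (s - θ) / cmoment μ S (-θ)) ∧
      (∃ g : GammaData, IsGammaType μ T {s | s.re < α + θ} g) ∧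
      (∀ s : ℂ, -α - θ < s.re → s.re < α →
        HasMoment μ (fun ω => S ω / T ω) s
          (Complex.Gamma (1 + θ) / Complex.Gamma (1 + θ / α) *
            (Complex.Gamma (1 - s / α) * Complex.Gamma (1 + s / α + θ / α) /
              (Complex.Gamma (1 - s) * Complex.Gamma (1 + s + θ)))) ∧
        cmoment μ (fun ω => S ω / T ω) s = cmoment μ S s * cmoment μ T (-s)) ∧
      (∃ g : GammaData,
        IsGammaType μ (fun ω => S ω / T ω) {s | -α - θ < s.re ∧ s.re < α} g ∧
        g.gam = 2 * (1 / α - 1) ∧ g.gam' = 0 ∧ g.del = θ * (1 / α - 1) ∧ g.kap = 0) ∧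
      rhoPlus μ (fun ω => S ω / T ω) = (α : ℝ) ∧
      rhoMinus μ (fun ω => S ω / T ω) = ((-α - θ : ℝ) : EReal)) := by
  refine ⟨fun α S S' hα hα1 h h' hind => ?_, fun α β S S' hα hαβ h h' hind => ?_,
    fun α θ S T hα hα1 hθ h hT hind => ?_⟩
  · refine ⟨fun s hs hs' => ⟨h.hasMoment_div h' hind hα ⟨hs, hs'⟩,
        h.cmoment_div_eq_mul h' hind hα hs, fun hs0 =>
          ⟨h.cmoment_div_eq_Gamma h' hind hα ⟨hs, hs'⟩ hs0,
            h.cmoment_div_eq_sin h' hind hα ⟨hs, hs'⟩ hs0⟩⟩,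
      h.exists_gammaData_div h' hind hα, h.rhoPlus_div h' hind hα hα1,
      h.rhoMinus_div h' hind hα hα1, h.isMittagLeffler hα, h'.isMittagLeffler hα,
      hind.comp (measurable_id.pow_const _) (measurable_id.pow_const _),
      h.ae_div_rpow_self_eq h',
      fun s hs hs' => ⟨h.hasMoment_div_rpow_self h' hind hα ⟨hs, hs'⟩,
        h.cmoment_div_rpow_self_eq_sin h' hind hα ⟨hs, hs'⟩⟩,
      h.exists_gammaData_div_rpow_self h' hind hα,
      h.rhoPlus_div_rpow h' hind hα hα1 hα (mul_one α),
      h.rhoMinus_div_rpow h' hind hα hα1 hα (mul_one α),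
      h.hasPosDensity_div_rpow_self h' hind hα hα1, h.hasPosDensity_div h' hind hα hα1, ?_⟩
    rintro rfl
    exact ⟨fun s hs hs' => h.cmoment_div_rpow_half h' hind ⟨hs, hs'⟩,
      h.hasLaw_div_rpow_half h' hind⟩
  · have hβ := hα.trans hαβ
    have hratio := div_pos hα hβ
    have hratio1 := (div_lt_one hβ).2 hαβ
    exact ⟨h.ae_div_rpow_div_rpow_one_div h' hα.ne',
      fun s hs hs' => ⟨h.hasMoment_div_rpow_one_div h' hind hα hβ ⟨hs, hs'⟩,
        h.cmoment_div_rpow_one_div h' s,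
        h.cmoment_div_rpow_one_div_eq_sin h' hind hα hβ ⟨hs, hs'⟩⟩,
      h.exists_gammaData_div_rpow_one_div h' hind hα hβ,
      h.rhoPlus_div_rpow h' hind hratio hratio1 (one_div_pos.2 hβ) (one_div_mul_eq_div β α),
      h.rhoMinus_div_rpow h' hind hratio hratio1 (one_div_pos.2 hβ) (one_div_mul_eq_div β α)⟩
  · exact ⟨h.integrable_rpow_neg hα hθ, integral_rpow_pos h.pos (h.integrable_rpow_neg hα hθ),
      fun s hs => ⟨h.hasMoment_tilt hα hθ hT hs, h.cmoment_tilt hα hθ hT s⟩,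
      h.exists_gammaData_tilt hα hθ hT,
      fun s hs hs' => ⟨h.hasMoment_div_tilt hα hθ hT hind ⟨hs, hs'⟩, h.cmoment_div_tilt hT hind s⟩,
      h.exists_gammaData_div_tilt hα hθ hT hind, h.rhoPlus_div_tilt hα hα1 hθ hT hind,
      h.rhoMinus_div_tilt hα hα1 hθ hT hind⟩

theorem mainTheorem7 {Ω : Type*} [MeasurableSpace Ω] (μ : Measure Ω) [IsProbabilityMeasure μ] :
    -- the Lamperti variable `L_α = S_α / S'_α` and its power `L_α ^ α`
    (∀ (α : ℝ) (S S' : Ω → ℝ), 0 < α → α < 1 →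
      IsPositiveStable α S μ → IsPositiveStable α S' μ → IndepFun S S' μ →
      -- moments of `L_α`
      (∀ s : ℂ, -α < s.re → s.re < α →
        HasMoment μ (fun ω => S ω / S' ω) s
          (Complex.Gamma (1 - s / α) * Complex.Gamma (1 + s / α) /
            (Complex.Gamma (1 - s) * Complex.Gamma (1 + s))) ∧
        cmoment μ (fun ω => S ω / S' ω) s = cmoment μ S s * cmoment μ S (-s) ∧
        (s ≠ 0 →
          cmoment μ (fun ω => S ω / S' ω) s =
            Complex.Gamma (s / α) * Complex.Gamma (1 - s / α) /
              (α * Complex.Gamma s * Complex.Gamma (1 - s)) ∧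
          cmoment μ (fun ω => S ω / S' ω) s =
            Complex.sin (Real.pi * s) / (α * Complex.sin (Real.pi * s / α)))) ∧
      (∃ g : GammaData,
        IsGammaType μ (fun ω => S ω / S' ω) {s | -α < s.re ∧ s.re < α} g ∧
        g.gam = 2 * α⁻¹ - 2 ∧ g.gam' = 0 ∧ g.del = 0 ∧ g.kap = 0 ∧ g.C₁ = 1 / α) ∧
      rhoPlus μ (fun ω => S ω / S' ω) = (α : ℝ) ∧
      rhoMinus μ (fun ω => S ω / S' ω) = ((-α : ℝ) : EReal) ∧
      -- `L_α ^ α` as a quotient of independent Mittag-Leffler variables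
      IsMittagLeffler α (fun ω => S ω ^ (-α)) μ ∧
      IsMittagLeffler α (fun ω => S' ω ^ (-α)) μ ∧
      IndepFun (fun ω => S ω ^ (-α)) (fun ω => S' ω ^ (-α)) μ ∧
      (∀ᵐ ω ∂μ, (S ω / S' ω) ^ α = S' ω ^ (-α) / S ω ^ (-α)) ∧
      -- moments of `L_α ^ α`
      (∀ s : ℂ, -1 < s.re → s.re < 1 →
        HasMoment μ (fun ω => (S ω / S' ω) ^ α) s
          (Complex.Gamma (1 - s) * Complex.Gamma (1 + s) /
            (Complex.Gamma (1 - α * s) * Complex.Gamma (1 + α * s))) ∧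
        (s ≠ 0 →
          cmoment μ (fun ω => (S ω / S' ω) ^ α) s =
            Complex.sin (Real.pi * α * s) / (α * Complex.sin (Real.pi * s)))) ∧
      (∃ g : GammaData,
        IsGammaType μ (fun ω => (S ω / S' ω) ^ α) {s | -1 < s.re ∧ s.re < 1} g ∧
        g.gam = 2 - 2 * α ∧ g.gam' = 0 ∧ g.del = 0 ∧ g.kap = 0 ∧ g.C₁ = 1 / α) ∧
      rhoPlus μ (fun ω => (S ω / S' ω) ^ α) = ((1 : ℝ) : EReal) ∧
      rhoMinus μ (fun ω => (S ω / S' ω) ^ α) = ((-1 : ℝ) : EReal) ∧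
      -- densities of `L_α ^ α` and `L_α`
      HasPosDensity μ (fun ω => (S ω / S' ω) ^ α) (fun x =>
        Real.sin (Real.pi * α) / (Real.pi * α) *
          (1 / (x ^ 2 + 2 * Real.cos (Real.pi * α) * x + 1))) ∧
      HasPosDensity μ (fun ω => S ω / S' ω) (fun x =>
        Real.sin (Real.pi * α) / Real.pi *
          (x ^ (α - 1) / (x ^ (2 * α) + 2 * Real.cos (Real.pi * α) * x ^ α + 1))) ∧
      -- the case `α = 1/2`
      (α = 1 / 2 →
        (∀ s : ℂ, -1 < s.re → s.re < 1 →
          cmoment μ (fun ω => (S ω / S' ω) ^ α) s = 1 / Complex.cos (Real.pi * s / 2)) ∧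
        HasLaw (fun ω => (S ω / S' ω) ^ α) ((cauchyMeasure 0 1).map fun x => |x|) μ)) ∧
    -- the Kotz-Ostrovskii variable `Y_{α,β} = L_{α/β} ^ (1/β)`
    (∀ (α β : ℝ) (S S' : Ω → ℝ), 0 < α → α < β → β ≤ 2 →
      IsPositiveStable (α / β) S μ → IsPositiveStable (α / β) S' μ → IndepFun S S' μ →
      (∀ᵐ ω ∂μ, ((S ω / S' ω) ^ (α / β)) ^ (1 / α) = (S ω / S' ω) ^ (1 / β)) ∧
      (∀ s : ℂ, -α < s.re → s.re < α →
        HasMoment μ (fun ω => (S ω / S' ω) ^ (1 / β)) s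
          (Complex.Gamma (1 + s / α) * Complex.Gamma (1 - s / α) /
            (Complex.Gamma (1 + s / β) * Complex.Gamma (1 - s / β))) ∧
        cmoment μ (fun ω => (S ω / S' ω) ^ (1 / β)) s =
          cmoment μ (fun ω => S ω / S' ω) (s / β) ∧
        (s ≠ 0 →
          cmoment μ (fun ω => (S ω / S' ω) ^ (1 / β)) s =
            β * Complex.sin (Real.pi * s / β) / (α * Complex.sin (Real.pi * s / α)))) ∧
      (∃ g : GammaData,
        IsGammaType μ (fun ω => (S ω / S' ω) ^ (1 / β)) {s | -α < s.re ∧ s.re < α} g ∧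
        g.gam = 2 * α⁻¹ - 2 * β⁻¹ ∧ g.gam' = 0 ∧ g.del = 0 ∧ g.kap = 0 ∧ g.C₁ = β / α) ∧
      rhoPlus μ (fun ω => (S ω / S' ω) ^ (1 / β)) = (α : ℝ) ∧
      rhoMinus μ (fun ω => (S ω / S' ω) ^ (1 / β)) = ((-α : ℝ) : EReal)) ∧
    -- James's variable `X_{α,θ} = S_α / S_{α,θ}`
    (∀ (α θ : ℝ) (S T : Ω → ℝ), 0 < α → α < 1 → -α < θ →
      IsPositiveStable α S μ → HasLaw T (powTilt (μ.map S) (-θ)) μ → IndepFun S T μ →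
      -- the tilting is well defined: `0 < E S_α ^ (-θ) < ∞`
      Integrable (fun ω => S ω ^ (-θ)) μ ∧ 0 < ∫ ω, S ω ^ (-θ) ∂μ ∧
      -- moments of the tilted variable
      (∀ s : ℂ, s.re < α + θ →
        HasMoment μ T s
          (Complex.Gamma (1 + θ) / Complex.Gamma (1 + θ / α) *
            (Complex.Gamma (1 - s / α + θ / α) / Complex.Gamma (1 - s + θ))) ∧
        cmoment μ T s = cmoment μ S (s - θ) / cmoment μ S (-θ)) ∧
      (∃ g : GammaData, IsGammaType μ T {s | s.re < α + θ} g) ∧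
      -- moments of `X_{α,θ}`
      (∀ s : ℂ, -α - θ < s.re → s.re < α →
        HasMoment μ (fun ω => S ω / T ω) s
          (Complex.Gamma (1 + θ) / Complex.Gamma (1 + θ / α) *
            (Complex.Gamma (1 - s / α) * Complex.Gamma (1 + s / α + θ / α) /
              (Complex.Gamma (1 - s) * Complex.Gamma (1 + s + θ)))) ∧
        cmoment μ (fun ω => S ω / T ω) s = cmoment μ S s * cmoment μ T (-s)) ∧
      (∃ g : GammaData,
        IsGammaType μ (fun ω => S ω / T ω) {s | -α - θ < s.re ∧ s.re < α} g ∧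
        g.gam = 2 * (1 / α - 1) ∧ g.gam' = 0 ∧ g.del = θ * (1 / α - 1) ∧ g.kap = 0) ∧
      rhoPlus μ (fun ω => S ω / T ω) = (α : ℝ) ∧
      rhoMinus μ (fun ω => S ω / T ω) = ((-α - θ : ℝ) : EReal)) :=
  let ⟨hLamperti, hKotzOstrovskii, hJames⟩ := mainTheorem7_general μ
  ⟨hLamperti, fun α β S S' hα hαβ _ => hKotzOstrovskii α β S S' hα hαβ, hJames⟩
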